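/- **Setting.** Let $n$ parties $0,\dots,n-1$, each with $k$ private inputs in $\mathbb Z/Q\mathbb Z$, $Q=2^{\ell}$ (for instance fixed-point encodings of real numbers), evaluate a *program* $P$: a finite list of operations on secret wires, with a list of output wires that are revealed to all parties. The operations are: sharing a private input (arithmetically, or its bits in binary form); public constants; addition, multiplication by a public constant and private multiplication in $\mathbb Z/Q\mathbb Z$; XOR, AND with a public word, private AND and shifts of $\ell$-bit words; conversion from arithmetic to binary sharing and back; and the comparator $[z<0]$, with $z$ read in two's complement. Let $f_P$ be the (deterministic) function of the inputs $x=(x_p)_p$ that $P$ computes on plain data. **The CrypTen protocol.** An arithmetic sharing $[x]$ of $x\in\mathbb Z/Q\mathbb Z$ consists of shares $[x]_p$ with $x=\sum_p[x]_p$; a binary sharing $\langle x\rangle$ of $x \in (\mathbb Z/2\mathbb Z)^\ell$ of shares with $x=\bigoplus_p\langle x\rangle_p$. * *Sharing.* Every pair of parties $p<q$ holds a common uniform seed, from which a generator $G$ produces a tape of masks $r_{pq}$, fresh masks for each step of the protocol. The zero-share of $p$ is $\sum_{q>p}r_{pq}-\sum_{q<p}r_{qp}$; the owner of a value adds it to its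 zero-share. * *Local operations.* Addition, XOR, shifts and operations with public values are computed on the shares; a public value is added by party $0$ only. * *Private multiplication.* A trusted third party (TTP) deals uniform sharings of a Beaver triple $(a,b,ab)$ with $a,b$ uniform. The parties broadcast their shares of $\epsilon=x-a$ and $\delta=y-b$ and set $[xy]=[ab]+\epsilon[b]+[a]\delta+\epsilon\delta$. Private AND is the same over $(\mathbb Z/2\mathbb Z)^{\ell}$. * *$[x]\to\langle x\rangle$.* Each party binary-shares the bits of its share $[x]_p$, and the $n$ shared words are added by a binary tree of carry-lookahead adders made of XOR, AND and shifts. * *$\langle x\rangle\to[x]$.* For each bit $x^{(b)}$, $0\le b<\ell$, the TTP deals uniform sharings $[r],\langle r\rangle$ of a uniform bit $r$; the parties open $z=x^{(b)}\oplus r$ and set $[x^{(b)}]=[r]+z-2[r]z$; then $[x]=\sum_b2^b[x^{(b)}]$. * *$[z<0]$.* Convert $[z]$ to $\langle z\rangle$, shift right by $\ell-1$, and convert bit $0$ to an arithmetic sharing. * *Output.* All parties broadcast their shares of the output wires and add them. **Adversary.** A static semi-honest adversary corrupts a set $C$ of at most $n-1$ of the $n\ge1$ parties. Its view consists of the inputs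 of the parties in $C$, the seeds of all pairs that meet $C$, all messages of the TTP to parties in $C$, and all broadcasts. For a generator $G$, let $\mathrm{Real}_G(x)$ be the joint law of the view of $C$ and of the output computed by the parties. For a simulator $\mathcal S$, let $\mathrm{Ideal}_{\mathcal S,G}(x)$ be the joint law of the view and output obtained as follows: draw uniform seeds for the pairs that meet $C$; give to $\mathcal S$ only the inputs of $C$, the value $f_P(x)$ and the tapes that $G$ generates from these seeds; the view is made of the inputs of $C$, the seeds, and the (randomized) answer of $\mathcal S$, and the output is $f_P(x)$. **Lemma.** For every $n,k,\ell$, every well-formed program $P$ and every set $C$ with $|C|\le n-1$ there is a simulator $\mathcal S$ (independent of $x$, $G$ and the set of seeds) such that: 1. *(Truly random zero-shares: perfect security.)* If the seeds are themselves uniform tapes of masks, i.e. $G=\mathrm{id}$, then $\mathrm{Real}_{\mathrm{id}}(x)=\mathrm{Ideal}_{\mathcal S,\mathrm{id}}(x)$ for all inputs $x$. 2. *(Pseudorandom zero-shares: security relative to the generator.)* For every finite nonempty set of seeds, every generator $G$, all inputs $x$, every randomized distinguisher $D$ with Boolean answers and every real $\eta$: let $H$ be the set of pairs of honest parties and, for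 $e\in H$ and $S\subseteq H$, let $T_{e,S}$ be the randomized test which, on a tape $w$, executes the protocol once on $x$, with $w$ as the masks of the pair $e$, uniform masks for the pairs in $S\setminus\{e\}$ and masks generated by $G$ from uniform seeds for all other pairs, and which applies $D$ to the resulting view and output. If each of the tests $T_{e,S}$ distinguishes the output of $G$ on a uniform seed from a uniform tape with advantage at most $\eta$, then $D$ distinguishes $\mathrm{Real}_G(x)$ from $\mathrm{Ideal}_{\mathcal S,G}(x)$ with advantage at most $|H|\,\eta$. Here the advantage of a test in telling two laws apart is the absolute difference of its probabilities of answering "true". In particular the protocol computes $f_P$, and the coalition learns nothing beyond its own inputs and the output. -/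

import Mathlib

namespace CrypTen

/-! ### Data -/

/-- The ring `ℤ/Qℤ` with `Q = 2 ^ ℓ` in which arithmetic shares live. -/
abbrev Arith (ℓ : ℕ) : Type := ZMod (2 ^ ℓ)

/-- Words of `ℓ` bits, with bitwise ring operations: `+` is XOR and `*` is AND. -/
abbrev Word (ℓ : ℕ) : Type := Fin ℓ → ZMod 2

/-- The bits of a ring element, least significant bit first. -/
def bits {ℓ : ℕ} (x : Arith ℓ) : Word ℓ := fun i => ((x.val / 2 ^ (i : ℕ) : ℕ) : ZMod 2)

/-- The number whose bits are given. -/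
def ofBits {ℓ : ℕ} (w : Word ℓ) : Arith ℓ := ∑ i : Fin ℓ, ((2 ^ (i : ℕ) * (w i).val : ℕ) : Arith ℓ)

/-- The integer that a ring element represents in two's complement. -/
def signed {ℓ : ℕ} (x : Arith ℓ) : ℤ :=
  if 2 * x.val < 2 ^ ℓ then (x.val : ℤ) else (x.val : ℤ) - 2 ^ ℓ

def shiftLeft {ℓ : ℕ} (s : ℕ) (w : Word ℓ) : Word ℓ :=
  fun i => if s ≤ (i : ℕ) then w ⟨i - s, lt_of_le_of_lt (Nat.sub_le _ _) i.2⟩ else 0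

def shiftRight {ℓ : ℕ} (s : ℕ) (w : Word ℓ) : Word ℓ :=
  fun i => if h : (i : ℕ) + s < ℓ then w ⟨i + s, h⟩ else 0

/-- The bit at a position, `0` beyond the length of the word. -/
def bitAt {ℓ : ℕ} (b : ℕ) (w : Word ℓ) : ZMod 2 := if h : b < ℓ then w ⟨b, h⟩ else 0

/-- The content of a wire (or a party's share of it): the component of the kind of the wire is
used, the other one is `0`. -/
structure Val (ℓ : ℕ) where
  arith : Arith ℓ := 0
  bin : Word ℓ := 0

/-! ### Programs and the function they compute -/

inductive Kind
  | arith
  | bin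

/-- The operations on secret values offered to the user, for `n` parties with `k` private inputs
each. The result of the `t`-th operation of a program is wire `t`; the arguments `i`, `j` are
earlier wires. -/
inductive Op (n k ℓ : ℕ)
  /-- private input `j` of party `p`, arithmetically shared -/
  | input (p : Fin n) (j : Fin k)
  /-- the bits of private input `j` of party `p`, binary shared -/
  | inputBin (p : Fin n) (j : Fin k)
  /-- a public constant -/
  | const (c : Arith ℓ)
  | constBin (c : Word ℓ)
  | add (i j : ℕ)
  /-- multiplication by a public constant -/
  | scale (c : Arith ℓ) (i : ℕ)
  /-- private multiplication -/
  | mul (i j : ℕ)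
  | xor (i j : ℕ)
  /-- bitwise AND with a public constant -/
  | mask (c : Word ℓ) (i : ℕ)
  /-- private bitwise AND -/
  | and (i j : ℕ)
  | shl (s i : ℕ)
  | shr (s i : ℕ)
  /-- conversion from arithmetic to binary sharing -/
  | a2b (i : ℕ)
  /-- conversion from binary to arithmetic sharing -/
  | b2a (i : ℕ)
  /-- the comparator `[z < 0]` -/
  | ltz (i : ℕ)

namespace Op

variable {n k ℓ : ℕ}

/-- The kind of the result. -/
def kind : Op n k ℓ → Kind
  | input _ _ | const _ | add _ _ | scale _ _ | mul _ _ | b2a _ | ltz _ => .arith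
  | inputBin _ _ | constBin _ | xor _ _ | mask _ _ | and _ _ | shl _ _ | shr _ _ | a2b _ => .bin

/-- The argument wires with the kinds they must have. -/
def args : Op n k ℓ → List (ℕ × Kind)
  | input _ _ | inputBin _ _ | const _ | constBin _ => []
  | add i j | mul i j => [(i, .arith), (j, .arith)]
  | xor i j | and i j => [(i, .bin), (j, .bin)]
  | scale _ i | a2b i | ltz i => [(i, .arith)]
  | mask _ i | shl _ i | shr _ i | b2a i => [(i, .bin)]

/-- The value of an operation on plain (not shared) data; `x` are the private inputs, `v` the
values of the earlier wires. -/
def eval (x : Fin n → Fin k → Arith ℓ) (v : ℕ → Val ℓ) : Op n k ℓ → Val ℓ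
  | input p j => { arith := x p j }
  | inputBin p j => { bin := bits (x p j) }
  | const c => { arith := c }
  | constBin c => { bin := c }
  | add i j => { arith := (v i).arith + (v j).arith }
  | scale c i => { arith := c * (v i).arith }
  | mul i j => { arith := (v i).arith * (v j).arith }
  | xor i j => { bin := (v i).bin + (v j).bin }
  | mask c i => { bin := c * (v i).bin }
  | and i j => { bin := (v i).bin * (v j).bin }
  | shl s i => { bin := shiftLeft s (v i).bin }
  | shr s i => { bin := shiftRight s (v i).bin }
  | a2b i => { bin := bits (v i).arith }
  | b2a i => { arith := ofBits (v i).bin }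
  | ltz i => { arith := if signed (v i).arith < 0 then 1 else 0 }

end Op

/-- A computation: a list of operations, and the arithmetic and the binary wires whose values are
revealed to all parties at the end. -/
structure Program (n k ℓ : ℕ) where
  ops : List (Op n k ℓ)
  outArith : List ℕ
  outBin : List ℕ

namespace Program

variable {n k ℓ : ℕ}

/-- Every operation refers to earlier wires of the right kinds, and so do the outputs. -/
def WellFormed (P : Program n k ℓ) : Prop :=
  (∀ t : Fin P.ops.length, ∀ r ∈ (P.ops[t]).args,
      r.1 < (t : ℕ) ∧ (P.ops[r.1]?).map Op.kind = some r.2) ∧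
    (∀ i ∈ P.outArith, (P.ops[i]?).map Op.kind = some .arith) ∧
    (∀ i ∈ P.outBin, (P.ops[i]?).map Op.kind = some .bin)

/-- One ring element per arithmetic output and one word per binary output. -/
abbrev Output (P : Program n k ℓ) : Type :=
  (Fin P.outArith.length → Arith ℓ) × (Fin P.outBin.length → Word ℓ)

/-- The values of all wires on plain data. -/
def wires (P : Program n k ℓ) (x : Fin n → Fin k → Arith ℓ) : List (Val ℓ) :=
  P.ops.foldl (fun v op => v ++ [op.eval x fun i => v.getD i {}]) []

/-- The ideal functionality: the output of the program on the private inputs `x`. -/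
def eval (P : Program n k ℓ) (x : Fin n → Fin k → Arith ℓ) : P.Output :=
  (fun o => ((P.wires x).getD (P.outArith.get o) {}).arith,
    fun o => ((P.wires x).getD (P.outBin.get o) {}).bin)

end Program

/-! ### The steps of the protocol -/

/-- The elementary steps that the parties execute. Step `t` of the code writes, in the memory of
each party, that party's share of the result at address `t`; `i`, `j` are addresses. -/
inductive Step (n k ℓ : ℕ)
  | shareArith (q : Fin n) (j : Fin k)
  | shareBin (q : Fin n) (j : Fin k)
  /-- party `q` shares the bits of its own arithmetic share of the value at address `i` -/
  | reshare (q : Fin n) (i : ℕ)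
  | const (c : Arith ℓ)
  | constBin (c : Word ℓ)
  | add (i j : ℕ)
  | scale (c : Arith ℓ) (i : ℕ)
  | mul (i j : ℕ)
  | xor (i j : ℕ)
  | mask (c : Word ℓ) (i : ℕ)
  | and (i j : ℕ)
  | shl (s i : ℕ)
  | shr (s i : ℕ)
  /-- arithmetic sharing of bit `b` of the binary shared word at address `i` -/
  | bit (b i : ℕ)

/-- Straight-line code under construction. -/
abbrev Build (n k ℓ : ℕ) := StateM (List (Step n k ℓ))

section Compile

variable {n k ℓ : ℕ}

/-- Append a step to the code and return the address of its result. -/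
def emit (s : Step n k ℓ) : Build n k ℓ ℕ := fun code => (code.length, code ++ [s])

/-- One level of the carry-lookahead network: from the generate and propagate words of blocks of
`2 ^ d` bits to those of blocks of `2 ^ (d + 1)` bits. -/
def carryLevel (gp : ℕ × ℕ) (d : ℕ) : Build n k ℓ (ℕ × ℕ) := do
  let gs ← emit (.shl (2 ^ d) gp.1)
  let t ← emit (.and gp.2 gs)
  let g ← emit (.xor gp.1 t)
  let ps ← emit (.shl (2 ^ d) gp.2)
  let p ← emit (.and gp.2 ps)
  pure (g, p)

/-- Carry-lookahead addition modulo `2 ^ ℓ` of two binary shared words. -/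
def adder (x y : ℕ) : Build n k ℓ ℕ := do
  let p ← emit (.xor x y)
  let g ← emit (.and x y)
  let gp ← (List.range (Nat.clog 2 ℓ)).foldlM carryLevel (g, p)
  let c ← emit (.shl 1 gp.1)
  emit (.xor p c)

/-- Add neighbours in a list of binary shared words. -/
def sumRound : List ℕ → Build n k ℓ (List ℕ)
  | x :: y :: l => do
    let s ← adder x y
    let r ← sumRound l
    pure (s :: r)
  | l => pure l

/-- Conversion from arithmetic to binary: every party shares the bits of its own share, and the
binary shared words are added in a binary tree of `⌈log₂ n⌉` rounds. -/
def convertA2B (i : ℕ) : Build n k ℓ ℕ := do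
  let l ← (List.finRange n).mapM fun q => emit (.reshare q i)
  let l ← (List.range (Nat.clog 2 n)).foldlM (fun l _ => sumRound l) l
  pure (l.getD 0 0)

/-- Conversion from binary to arithmetic: the sum of `2 ^ b` times the shared `b`-th bit. -/
def convertB2A (i : ℕ) : Build n k ℓ ℕ := do
  let z ← emit (.const 0)
  (List.range ℓ).foldlM (fun acc b => do
    let r ← emit (.bit b i)
    let r ← emit (.scale (2 ^ b) r)
    emit (.add acc r)) z

/-- The comparator: convert to binary, shift the sign bit to position `0`, and convert this bit to
an arithmetic sharing. -/
def comparator (i : ℕ) : Build n k ℓ ℕ := do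
  let w ← convertA2B i
  let s ← emit (.shr (ℓ - 1) w)
  emit (.bit 0 s)

/-- The steps that implement an operation; `env` gives the addresses of the earlier wires. -/
def Op.compile (env : List ℕ) : Op n k ℓ → Build n k ℓ ℕ
  | .input p j => emit (.shareArith p j)
  | .inputBin p j => emit (.shareBin p j)
  | .const c => emit (.const c)
  | .constBin c => emit (.constBin c)
  | .add i j => emit (.add (env.getD i 0) (env.getD j 0))
  | .scale c i => emit (.scale c (env.getD i 0))
  | .mul i j => emit (.mul (env.getD i 0) (env.getD j 0))
  | .xor i j => emit (.xor (env.getD i 0) (env.getD j 0))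
  | .mask c i => emit (.mask c (env.getD i 0))
  | .and i j => emit (.and (env.getD i 0) (env.getD j 0))
  | .shl s i => emit (.shl s (env.getD i 0))
  | .shr s i => emit (.shr s (env.getD i 0))
  | .a2b i => convertA2B (env.getD i 0)
  | .b2a i => convertB2A (env.getD i 0)
  | .ltz i => comparator (env.getD i 0)

/-- The addresses of the wires of a program, and its code. -/
def Program.compile (P : Program n k ℓ) : List ℕ × List (Step n k ℓ) :=
  (P.ops.foldlM (fun env op => do
    let a ← op.compile env
    pure (env ++ [a])) ([] : List ℕ) : Build n k ℓ (List ℕ)).run []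

def Program.addr (P : Program n k ℓ) (i : ℕ) : ℕ := P.compile.1.getD i 0

def Program.code (P : Program n k ℓ) : List (Step n k ℓ) := P.compile.2

end Compile

/-! ### Correlated randomness -/

/-- Two distinct parties, in increasing order. Each pair holds a common seed. -/
abbrev Pair (n : ℕ) : Type := {e : Fin n × Fin n // e.1 < e.2}

/-- The masks that one pair uses in a protocol of `T` steps. -/
abbrev Tape (T ℓ : ℕ) : Type := Fin T → Arith ℓ × Word ℓ

/-- The share of party `p` in the sharing of `0` defined by masks `m` of the pairs: the smaller
party of a pair adds the mask, the larger one subtracts it. Only the pairs that contain `p`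
contribute. -/
def zeroShare {n : ℕ} {R : Type} [AddCommGroup R] (m : Pair n → R) (p : Fin n) : R :=
  ∑ e : Pair n, if e.1.1 = p then m e else if e.1.2 = p then -m e else 0

/-- The additive sharing of `s` in which the shares of all parties but the first one are those
of `z`. -/
def dealShare {n : ℕ} {R : Type} [AddCommGroup R] (s : R) (z : Fin n → R) (p : Fin n) : R :=
  if (p : ℕ) = 0 then s - ∑ q ∈ Finset.univ.erase p, z q else z p

/-- The coins for a Beaver triple: `a`, `b`, and the coins for sharing `a`, `b` and `a * b`. -/
abbrev TripleCoins (n : ℕ) (R : Type) : Type :=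
  (R × R) × (Fin n → R) × (Fin n → R) × (Fin n → R)

def dealTriple {n : ℕ} {R : Type} [CommRing R] (c : TripleCoins n R) (p : Fin n) : R × R × R :=
  (dealShare c.1.1 c.2.1 p, dealShare c.1.2 c.2.2.1 p, dealShare (c.1.1 * c.1.2) c.2.2.2 p)

/-- The coins for a random bit and for its arithmetic and binary sharings. -/
abbrev BitCoins (n ℓ : ℕ) : Type := ZMod 2 × (Fin n → Arith ℓ) × (Fin n → ZMod 2)

def dealBit {n ℓ : ℕ} (c : BitCoins n ℓ) (p : Fin n) : Arith ℓ × ZMod 2 :=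
  (dealShare ((c.1.val : ℕ) : Arith ℓ) c.2.1 p, dealShare c.1 c.2.2 p)

/-- The coins of the trusted third party for one step. -/
abbrev Coins (n ℓ : ℕ) : Type :=
  TripleCoins n (Arith ℓ) × TripleCoins n (Word ℓ) × BitCoins n ℓ

instance {n ℓ : ℕ} : Fintype (TripleCoins n (Arith ℓ)) := inferInstance

instance {n ℓ : ℕ} : Fintype (TripleCoins n (Word ℓ)) := inferInstance

instance {n ℓ : ℕ} : Fintype (BitCoins n ℓ) := inferInstance

instance {n ℓ : ℕ} : Fintype (Coins n ℓ) := inferInstance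

/-- What the trusted third party sends to a party for one step; components that the step does not
need are `0`. -/
structure Dealt (ℓ : ℕ) where
  triple : Arith ℓ × Arith ℓ × Arith ℓ := 0
  tripleBin : Word ℓ × Word ℓ × Word ℓ := 0
  bit : Arith ℓ × ZMod 2 := 0

/-- The message of the trusted third party to party `p` for one step. -/
def deal {n k ℓ : ℕ} (c : Coins n ℓ) (p : Fin n) : Step n k ℓ → Dealt ℓ
  | .mul _ _ => { triple := dealTriple c.1 p }
  | .and _ _ => { tripleBin := dealTriple c.2.1 p }
  | .bit _ _ => { bit := dealBit c.2.2 p }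
  | _ => {}

/-! ### Execution -/

/-- What a party broadcasts in one step; components that the step does not need are `0`. -/
structure Message (ℓ : ℕ) where
  arith : Arith ℓ × Arith ℓ := 0
  bin : Word ℓ × Word ℓ := 0
  bit : ZMod 2 := 0

section Execution

variable {n k ℓ : ℕ}

/-- The memory of one party: its shares. -/
abbrev Memory (ℓ : ℕ) : Type := ℕ → Val ℓ

/-- The broadcast of a party with memory `M` that was dealt `d`. -/
def send (M : Memory ℓ) (d : Dealt ℓ) : Step n k ℓ → Message ℓ
  | .mul i j => { arith := ((M i).arith - d.triple.1, (M j).arith - d.triple.2.1) }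
  | .and i j => { bin := ((M i).bin - d.tripleBin.1, (M j).bin - d.tripleBin.2.1) }
  | .bit b i => { bit := bitAt b (M i).bin + d.bit.2 }
  | _ => {}

/-- A public value as a share: the first party holds it, the other parties hold `0`. -/
def publicShare {R : Type} [Zero R] (p : Fin n) (c : R) : R := if (p : ℕ) = 0 then c else 0

/-- The share of a party of a product, from its shares of a Beaver triple and the opened
differences. -/
def beaver {R : Type} [CommRing R] (p : Fin n) (d : R × R × R) (ε δ : R) : R :=
  d.2.2 + ε * d.2.1 + d.1 * δ + publicShare p (ε * δ)

/-- The share that party `p` computes in a step, from its private inputs `x`, its shares `z` of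
zero, its memory `M`, what it was dealt, and the broadcasts `msg` of all parties. -/
def receive (p : Fin n) (x : Fin k → Arith ℓ) (z : Arith ℓ × Word ℓ) (M : Memory ℓ) (d : Dealt ℓ)
    (msg : Fin n → Message ℓ) : Step n k ℓ → Val ℓ
  | .shareArith q j => { arith := z.1 + if p = q then x j else 0 }
  | .shareBin q j => { bin := z.2 + if p = q then bits (x j) else 0 }
  | .reshare q i => { bin := z.2 + if p = q then bits (M i).arith else 0 }
  | .const c => { arith := publicShare p c }
  | .constBin c => { bin := publicShare p c }
  | .add i j => { arith := (M i).arith + (M j).arith }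
  | .scale c i => { arith := c * (M i).arith }
  | .mul _ _ => { arith := beaver p d.triple (∑ q, (msg q).arith.1) (∑ q, (msg q).arith.2) }
  | .xor i j => { bin := (M i).bin + (M j).bin }
  | .mask c i => { bin := c * (M i).bin }
  | .and _ _ => { bin := beaver p d.tripleBin (∑ q, (msg q).bin.1) (∑ q, (msg q).bin.2) }
  | .shl s i => { bin := shiftLeft s (M i).bin }
  | .shr s i => { bin := shiftRight s (M i).bin }
  | .bit _ _ =>
    let z' : Arith ℓ := ((∑ q, (msg q).bit : ZMod 2).val : ℕ)
    { arith := d.bit.1 + publicShare p z' - 2 * d.bit.1 * z' }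

/-- The memories of all parties before step `t`, where `m` are the masks of the pairs and `c` the
coins of the trusted third party. -/
def memory (code : List (Step n k ℓ)) (x : Fin n → Fin k → Arith ℓ)
    (m : Pair n → Tape code.length ℓ) (c : Fin code.length → Coins n ℓ) :
    ℕ → Fin n → Memory ℓ
  | 0 => fun _ _ => {}
  | t + 1 => fun p =>
    if h : t < code.length then
      Function.update (memory code x m c t p) t
        (receive p (x p) (zeroShare (fun e => m e ⟨t, h⟩) p) (memory code x m c t p)
          (deal (c ⟨t, h⟩) p code[t])
          (fun q => send (memory code x m c t q) (deal (c ⟨t, h⟩) q code[t]) code[t])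
          code[t])
    else memory code x m c t p

end Execution

/-! ### Views and security -/

section Security

variable {n k ℓ : ℕ}

/-- The pairs of parties that are both honest, if the parties in `C` are corrupted. -/
def honestPairs (C : Finset (Fin n)) : Finset (Pair n) :=
  Finset.univ.filter fun e => e.1.1 ∉ C ∧ e.1.2 ∉ C

/-- The seeds known to the coalition `C`: those of the pairs that contain a party in `C`. -/
abbrev KnownSeeds (C : Finset (Fin n)) (Seed : Type) : Type := {e : Pair n // e ∉ honestPairs C} → Seed

/-- The private inputs of the parties in `C`. -/
abbrev KnownInputs (C : Finset (Fin n)) (k ℓ : ℕ) : Type := C → Fin k → Arith ℓ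

/-- What the parties in `C` receive during the protocol. -/
structure Received (P : Program n k ℓ) (C : Finset (Fin n)) where
  /-- the messages of the trusted third party to the parties in `C` -/
  dealt : Fin P.code.length → C → Dealt ℓ
  /-- the broadcasts of all parties -/
  broadcast : Fin P.code.length → Fin n → Message ℓ
  /-- the shares of the outputs, broadcast by all parties at the end -/
  opened : Fin n → P.Output

/-- The view of the coalition `C`. -/
structure View (P : Program n k ℓ) (C : Finset (Fin n)) (Seed : Type) where
  inputs : KnownInputs C k ℓ
  seeds : KnownSeeds C Seed
  received : Received P C

/-- The protocol on inputs `x`, with masks `m` of the pairs and coins `c` of the trusted third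
party: what the coalition `C` receives, and the output, which every party computes as the sum of
the shares broadcast at the end. -/
def Program.run (P : Program n k ℓ) (C : Finset (Fin n)) (x : Fin n → Fin k → Arith ℓ)
    (m : Pair n → Tape P.code.length ℓ) (c : Fin P.code.length → Coins n ℓ) :
    Received P C × P.Output :=
  let M := memory P.code x m c
  let final := M P.code.length
  let opened : Fin n → P.Output := fun p =>
    (fun o => (final p (P.addr (P.outArith.get o))).arith,
      fun o => (final p (P.addr (P.outBin.get o))).bin)
  ({ dealt := fun t p => deal (c t) p P.code[t]
     broadcast := fun t p => send (M t p) (deal (c t) p P.code[t]) P.code[t]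
     opened := opened },
    ∑ p, opened p)

/-- The real experiment: the joint law of the view of `C` and of the output of the parties, when
the masks of each pair are generated by `G` from the common seed of the pair. -/
noncomputable def Program.real (P : Program n k ℓ) (C : Finset (Fin n)) {Seed : Type}
    [Fintype Seed] [Nonempty Seed] (G : Seed → Tape P.code.length ℓ)
    (x : Fin n → Fin k → Arith ℓ) : PMF (View P C Seed × P.Output) :=
  (PMF.uniformOfFintype (Pair n → Seed)).bind fun s =>
    (PMF.uniformOfFintype (Fin P.code.length → Coins n ℓ)).map fun c =>
      let r := P.run C x (fun e => G (s e)) c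
      (⟨fun p => x p, fun e => s e, r.1⟩, r.2)

/-- A simulator gets the inputs of the corrupted parties, the output of the functionality, and the
masks generated from the seeds of the corrupted parties. -/
abbrev Simulator (P : Program n k ℓ) (C : Finset (Fin n)) : Type :=
  KnownInputs C k ℓ → P.Output → KnownSeeds C (Tape P.code.length ℓ) → PMF (Received P C)

/-- The ideal experiment: the view is made of the inputs of the corrupted parties, of fresh uniform
seeds, and of what the simulator produces; the output is that of the functionality. -/
noncomputable def Program.ideal (P : Program n k ℓ) (C : Finset (Fin n)) (Sim : Simulator P C)
    {Seed : Type} [Fintype Seed] [Nonempty Seed] (G : Seed → Tape P.code.length ℓ)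
    (x : Fin n → Fin k → Arith ℓ) : PMF (View P C Seed × P.Output) :=
  (PMF.uniformOfFintype (KnownSeeds C Seed)).bind fun s =>
    (Sim (fun p => x p) (P.eval x) (fun e => G (s e))).map fun r =>
      (⟨fun p => x p, s, r⟩, P.eval x)

/-- The advantage of the randomized test `D` in telling `μ` from `ν`. -/
noncomputable def advantage {α : Type} (D : α → PMF Bool) (μ ν : PMF α) : ℝ :=
  |((μ.bind D) true).toReal - ((ν.bind D) true).toReal|

/-- The advantage of a test in telling the output of the generator `G` on a uniform seed from a
uniform tape. -/
noncomputable def generatorAdvantage {Seed : Type} [Fintype Seed] [Nonempty Seed] {T : ℕ}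
    (G : Seed → Tape T ℓ) (D : Tape T ℓ → PMF Bool) : ℝ :=
  advantage D ((PMF.uniformOfFintype Seed).map G) (PMF.uniformOfFintype (Tape T ℓ))

/-- The test of a tape `w` that executes the protocol once and applies `D` to the result: the pair
`e₀` uses the masks `w`, the pairs in `S` use uniform masks, all other pairs use `G`. -/
noncomputable def Program.tapeTest (P : Program n k ℓ) (C : Finset (Fin n)) {Seed : Type}
    [Fintype Seed] [Nonempty Seed] (G : Seed → Tape P.code.length ℓ)
    (x : Fin n → Fin k → Arith ℓ) (D : View P C Seed × P.Output → PMF Bool)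
    (e₀ : Pair n) (S : Finset (Pair n)) (w : Tape P.code.length ℓ) : PMF Bool :=
  (PMF.uniformOfFintype (Pair n → Seed)).bind fun s =>
    (PMF.uniformOfFintype (Pair n → Tape P.code.length ℓ)).bind fun u =>
      (PMF.uniformOfFintype (Fin P.code.length → Coins n ℓ)).bind fun c =>
        let r := P.run C x
          (fun e => if e = e₀ then w else if e ∈ S then u e else G (s e)) c
        D (⟨fun p => x p, fun e => s e, r.1⟩, r.2)

end Security

end CrypTen

/-!
The theorem has two independent halves.

*Correctness.* In every step the shares of the parties add up to the plain value of the step: the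
pairwise masks cancel (`sum_zeroShare`), and so do the masks of Beaver triples and of random bits
(`total_receive`). The compiled code then computes what the program asks for, by reasoning about
straight-line code with triples (`Ensures`). The only arithmetic content is the carry-lookahead
adder: with `c (i + 1) = g i + p i * c i` as definition of the carries, merging blocks of positions
preserves the relation between carries at distance `2 ^ d` (`IsLookahead.double`), and the carries
are those of the addition of numbers (`bits_add`). Hence the opened outputs always add up to the
value of the functionality (`Program.run_snd`).

*Privacy.* Fix an honest party `p₀`. The simulator executes the protocol itself, with zeros as
inputs of the honest parties, and then corrects the output shares opened by `p₀`, the only ones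
that the known output has to determine. To compare this with the real execution, the randomness of
one is mapped to that of the other so that all parties except `p₀` hold the same shares throughout
and all broadcasts agree. When another honest party `q` deals a share of a different input, the
mask of the pair of `q` and `p₀` is changed, which shifts the difference to `p₀`; when `p₀` uses a
different share in a multiplication or a bit conversion, its shares of the triple or of the random
bit are changed by the same amount, together with the shared secrets, so that its broadcast and the
messages to the other parties stay the same. In each step the change depends on earlier steps only,
so such a twin exists and is unique (`existsUnique_isTwin`); as the relation is symmetric, passing
to the twin is a bijection and preserves the uniform law (`exists_equiv_isTwin`,
`hybrid_honestPairs`).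

With seeds in place of uniform tapes, the masks of the honest pairs are replaced by uniform ones one
pair at a time. Each replacement is one of the tests of the hypothesis (`hybrid_bind`,
`hybrid_insert_bind`), so the advantages add up to at most `η` for each honest pair. With `G = id`
the replacement changes nothing, since the coalition does not see the seeds of honest pairs
(`hybrid_id`).
-/

namespace CrypTen

/-! ### Sums of shares -/

section Sums

variable {n ℓ : ℕ}

theorem sum_zeroShare {R : Type} [AddCommGroup R] (m : Pair n → R) :
    ∑ p, zeroShare m p = 0 := by
  simp only [zeroShare]
  rw [Finset.sum_comm]
  refine Finset.sum_eq_zero fun e _ => ?_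
  have hne : e.1.1 ≠ e.1.2 := e.2.ne
  have h : ∀ p : Fin n, (if e.1.1 = p then m e else if e.1.2 = p then -m e else 0) =
      (if e.1.1 = p then m e else 0) + (if e.1.2 = p then -m e else 0) := by
    intro p
    by_cases h1 : e.1.1 = p
    · have h2 : e.1.2 ≠ p := fun h2 => hne (h1.trans h2.symm)
      simp [h1, h2]
    · simp [h1]
  simp [h, Finset.sum_add_distrib]

theorem zeroShare_add {R : Type} [AddCommGroup R] (m m' : Pair n → R) (p : Fin n) :
    zeroShare (m + m') p = zeroShare m p + zeroShare m' p := by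
  simp only [zeroShare, ← Finset.sum_add_distrib]
  refine Finset.sum_congr rfl fun e _ => ?_
  split_ifs <;> simp [add_comm]

theorem sum_dealShare {R : Type} [AddCommGroup R] (hn : 0 < n) (s : R) (z : Fin n → R) :
    ∑ p, dealShare s z p = s := by
  have h0 : (⟨0, hn⟩ : Fin n) ∈ Finset.univ := Finset.mem_univ _
  rw [← Finset.add_sum_erase _ _ h0]
  have h : ∑ p ∈ Finset.univ.erase (⟨0, hn⟩ : Fin n), dealShare s z p =
      ∑ p ∈ Finset.univ.erase (⟨0, hn⟩ : Fin n), z p := by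
    refine Finset.sum_congr rfl fun p hp => ?_
    have : (p : ℕ) ≠ 0 := fun h => (Finset.mem_erase.1 hp).1 (Fin.ext h)
    simp [dealShare, this]
  rw [h]
  simp [dealShare]

theorem sum_publicShare {R : Type} [AddCommMonoid R] (hn : 0 < n) (c : R) :
    ∑ p : Fin n, publicShare p c = c := by
  have h : ∀ p : Fin n, publicShare p c = if p = ⟨0, hn⟩ then c else 0 := by
    intro p
    simp [publicShare, Fin.ext_iff]
  simp [h]

theorem sum_beaver {R : Type} [CommRing R] (hn : 0 < n) (c : TripleCoins n R) (ε δ : R) :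
    ∑ p, beaver p (dealTriple c p) ε δ = (ε + c.1.1) * (δ + c.1.2) := by
  simp only [beaver, dealTriple, Finset.sum_add_distrib, ← Finset.mul_sum, ← Finset.sum_mul,
    sum_dealShare hn, sum_publicShare hn]
  ring

theorem sum_dealTriple_fst {R : Type} [CommRing R] (hn : 0 < n) (c : TripleCoins n R) :
    ∑ p, (dealTriple c p).1 = c.1.1 :=
  sum_dealShare hn _ _

theorem sum_dealTriple_snd {R : Type} [CommRing R] (hn : 0 < n) (c : TripleCoins n R) :
    ∑ p, (dealTriple c p).2.1 = c.1.2 :=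
  sum_dealShare hn _ _

theorem shiftLeft_sum {ι : Type} (s : Finset ι) (d : ℕ) (w : ι → Word ℓ) :
    ∑ p ∈ s, shiftLeft d (w p) = shiftLeft d (∑ p ∈ s, w p) := by
  ext i
  simp only [shiftLeft, Finset.sum_apply]
  split_ifs <;> simp

theorem shiftRight_sum {ι : Type} (s : Finset ι) (d : ℕ) (w : ι → Word ℓ) :
    ∑ p ∈ s, shiftRight d (w p) = shiftRight d (∑ p ∈ s, w p) := by
  ext i
  simp only [shiftRight, Finset.sum_apply]
  split_ifs <;> simp

theorem bitAt_sum {ι : Type} (s : Finset ι) (b : ℕ) (w : ι → Word ℓ) :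
    ∑ p ∈ s, bitAt b (w p) = bitAt b (∑ p ∈ s, w p) := by
  simp only [bitAt]
  split_ifs <;> simp

/-- Exclusive or, written with arithmetic on numbers: unmasking the opened bit `y + r` by `r`
gives back `y`. -/
theorem val_unmask {ℓ : ℕ} (y r : ZMod 2) :
    ((r.val : ℕ) : Arith ℓ) + (((y + r).val : ℕ) : Arith ℓ) -
      2 * ((r.val : ℕ) : Arith ℓ) * (((y + r).val : ℕ) : Arith ℓ) = ((y.val : ℕ) : Arith ℓ) := by
  have h2 : (1 : ZMod 2) + 1 = 0 := by decide
  have h1 : (1 : ZMod 2).val = 1 := rfl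
  have h0 : (0 : ZMod 2).val = 0 := rfl
  have hc : ∀ a : ZMod 2, a = 0 ∨ a = 1 := by decide
  rcases hc y with rfl | rfl <;> rcases hc r with rfl | rfl <;>
    simp only [h0, h1, h2, add_zero, zero_add, Nat.cast_zero, Nat.cast_one] <;> ring

end Sums

/-! ### The values computed by the steps of the protocol -/

section Values

variable {n k ℓ : ℕ}

/-- The value at address `i` that is shared among the memories `M` of the parties. -/
def total (M : Fin n → Memory ℓ) (i : ℕ) : Val ℓ :=
  { arith := ∑ p, (M p i).arith, bin := ∑ p, (M p i).bin }

/-- The addresses that a step reads. -/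
def Step.reads : Step n k ℓ → List ℕ
  | shareArith _ _ | shareBin _ _ | const _ | constBin _ => []
  | reshare _ i | scale _ i | mask _ i | shl _ i | shr _ i | bit _ i => [i]
  | add i j | mul i j | xor i j | and i j => [i, j]

/-- The value whose sharing a step writes. It is a function of the values at the addresses that
the step reads, except for `reshare`, which refers to the share of a single party. -/
def Step.value (x : Fin n → Fin k → Arith ℓ) (M : Fin n → Memory ℓ) : Step n k ℓ → Val ℓ
  | shareArith q j => { arith := x q j }
  | shareBin q j => { bin := bits (x q j) }
  | reshare q i => { bin := bits (M q i).arith }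
  | const c => { arith := c }
  | constBin c => { bin := c }
  | add i j => { arith := (total M i).arith + (total M j).arith }
  | scale c i => { arith := c * (total M i).arith }
  | mul i j => { arith := (total M i).arith * (total M j).arith }
  | xor i j => { bin := (total M i).bin + (total M j).bin }
  | mask c i => { bin := c * (total M i).bin }
  | and i j => { bin := (total M i).bin * (total M j).bin }
  | shl s i => { bin := shiftLeft s (total M i).bin }
  | shr s i => { bin := shiftRight s (total M i).bin }
  | bit b i => { arith := (((bitAt b (total M i).bin).val : ℕ) : Arith ℓ) }

theorem Step.value_congr (x : Fin n → Fin k → Arith ℓ) {M M' : Fin n → Memory ℓ}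
    (s : Step n k ℓ) (h : ∀ i ∈ s.reads, ∀ p, M p i = M' p i) : s.value x M = s.value x M' := by
  have ht : ∀ i ∈ s.reads, total M i = total M' i := by
    intro i hi
    simp [total, h i hi]
  cases s <;> simp_all [Step.value, Step.reads]

/-- One step is correct: the new shares add up to the value of the step. -/
theorem total_receive (hn : 0 < n) (x : Fin n → Fin k → Arith ℓ) (M : Fin n → Memory ℓ)
    (z : Pair n → Arith ℓ × Word ℓ) (c : Coins n ℓ) (s : Step n k ℓ) (t : ℕ) :
    total (fun p => Function.update (M p) t (receive p (x p) (zeroShare z p) (M p) (deal c p s)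
      (fun q => send (M q) (deal c q s) s) s)) t = s.value x M := by
  have hz1 : ∑ p, (zeroShare z p).1 = 0 := by rw [← Prod.fst_sum, sum_zeroShare]; rfl
  have hz2 : ∑ p, (zeroShare z p).2 = 0 := by rw [← Prod.snd_sum, sum_zeroShare]; rfl
  simp only [total, Function.update_self]
  cases s with
  | shareArith q j => simp [receive, Step.value, Finset.sum_add_distrib, hz1]
  | shareBin q j => simp [receive, Step.value, Finset.sum_add_distrib, hz2]
  | reshare q i => simp [receive, Step.value, Finset.sum_add_distrib, hz2]
  | const c => simp [receive, Step.value, sum_publicShare hn]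
  | constBin c => simp [receive, Step.value, sum_publicShare hn]
  | add i j => simp [receive, Step.value, total, Finset.sum_add_distrib]
  | scale c i => simp [receive, Step.value, total, Finset.mul_sum]
  | mul i j =>
    simp only [receive, Step.value, deal, send, total, Finset.sum_sub_distrib,
      sum_dealTriple_fst hn, sum_dealTriple_snd hn, sum_beaver hn]
    simp
  | xor i j => simp [receive, Step.value, total, Finset.sum_add_distrib]
  | mask c i => simp [receive, Step.value, total, Finset.mul_sum]
  | and i j =>
    simp only [receive, Step.value, deal, send, total, Finset.sum_sub_distrib,
      sum_dealTriple_fst hn, sum_dealTriple_snd hn, sum_beaver hn]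
    simp
  | shl s i => simp [receive, Step.value, total, shiftLeft_sum]
  | shr s i => simp [receive, Step.value, total, shiftRight_sum]
  | bit b i =>
    simp only [receive, Step.value, deal, send, total, dealBit, Finset.sum_add_distrib,
      Finset.sum_sub_distrib, ← Finset.mul_sum, ← Finset.sum_mul, sum_dealShare hn,
      sum_publicShare hn, bitAt_sum, val_unmask]
    simp

section Memory

variable (code : List (Step n k ℓ)) (x : Fin n → Fin k → Arith ℓ)
  (m : Pair n → Tape code.length ℓ) (c : Fin code.length → Coins n ℓ)

theorem memory_succ {t : ℕ} (ht : t < code.length) (p : Fin n) :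
    memory code x m c (t + 1) p = Function.update (memory code x m c t p) t
      (receive p (x p) (zeroShare (fun e => m e ⟨t, ht⟩) p) (memory code x m c t p)
        (deal (c ⟨t, ht⟩) p code[t])
        (fun q => send (memory code x m c t q) (deal (c ⟨t, ht⟩) q code[t]) code[t])
        code[t]) := by
  simp [memory, ht]

/-- Every address is written only once. -/
theorem memory_of_lt {i t t' : ℕ} (hi : i < t) (ht : t ≤ t') (ht' : t' ≤ code.length)
    (p : Fin n) :
    memory code x m c t' p i = memory code x m c t p i := by
  induction t', ht using Nat.le_induction with
  | base => rfl
  | succ t' ht ih =>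
    rw [← ih (by omega), memory_succ code x m c ht', Function.update_of_ne (by omega)]

/-- At the end of the execution, the value at an address is the one that its step computes from
the final memories: what a step reads does not change later. -/
theorem total_memory (hn : 0 < n) {t : ℕ} {s : Step n k ℓ} (ht : code[t]? = some s)
    (hs : ∀ i ∈ s.reads, i < t) :
    total (memory code x m c code.length) t = s.value x (memory code x m c code.length) := by
  obtain ⟨hlt, rfl⟩ := List.getElem?_eq_some_iff.1 ht
  have h1 : total (memory code x m c code.length) t = total (memory code x m c (t + 1)) t := by
    simp only [total, memory_of_lt code x m c (Nat.lt_succ_self t) hlt le_rfl]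
  rw [h1, funext (memory_succ code x m c hlt), total_receive hn]
  exact Step.value_congr x _ fun i hi p =>
    (memory_of_lt code x m c (hs i hi) hlt.le le_rfl p).symm

end Memory

end Values

/-! ### Carry-lookahead addition -/

section Carry

variable {ℓ : ℕ}

/-- The carry into position `i` of an addition with generate word `g` and propagate word `p`. -/
def carry (g p : Word ℓ) : ℕ → ZMod 2
  | 0 => 0
  | i + 1 => if h : i < ℓ then g ⟨i, h⟩ + p ⟨i, h⟩ * carry g p i else 0

/-- `G` and `Q` are generate and propagate words of the blocks of `s` positions that end at each
position. A block that reaches position `0` generates the carry itself. Nothing is said about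
propagation through such blocks, since no carry enters at position `0`. -/
def IsLookahead (g p : Word ℓ) (s : ℕ) (G Q : Word ℓ) : Prop :=
  ∀ i : Fin ℓ, ((i : ℕ) + 1 ≤ s → G i = carry g p (i + 1)) ∧
    (s ≤ (i : ℕ) + 1 → carry g p (i + 1) = G i + Q i * carry g p (i + 1 - s))

theorem isLookahead_one (g p : Word ℓ) : IsLookahead g p 1 g p := by
  intro i
  refine ⟨fun h => ?_, fun _ => by simp [carry]⟩
  obtain ⟨i, hi⟩ := i
  obtain rfl : i = 0 := by simpa using h
  simp [carry, hi]

/-- Merging each block with the block before it doubles the length of the blocks. -/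
theorem IsLookahead.double {g p G Q : Word ℓ} {s : ℕ} (h : IsLookahead g p s G Q) :
    IsLookahead g p (2 * s) (G + Q * shiftLeft s G) (Q * shiftLeft s Q) := by
  intro i
  obtain ⟨h1, h2⟩ := h i
  by_cases hs : s ≤ (i : ℕ)
  · obtain ⟨h3, h4⟩ := h ⟨i - s, by omega⟩
    simp only [show (i : ℕ) - s + 1 = i + 1 - s by omega] at h3 h4
    refine ⟨fun hi => ?_, fun hi => ?_⟩
    · rw [h2 (by omega)]
      simp [shiftLeft, hs, h3 (by omega)]
    · rw [h2 (by omega), h4 (by omega)]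
      simp only [Pi.add_apply, Pi.mul_apply, shiftLeft, hs, if_true,
        show (i : ℕ) + 1 - s - s = i + 1 - 2 * s by omega]
      ring
  · refine ⟨fun hi => by simp [shiftLeft, hs, h1 (by omega)], fun hi => ?_⟩
    have hs' : (i : ℕ) + 1 - s = 0 := by omega
    rw [h2 (by omega)]
    simp [shiftLeft, hs, hs', carry]

theorem IsLookahead.shiftLeft_one {g p G Q : Word ℓ} {s : ℕ} (h : IsLookahead g p s G Q)
    (hs : ℓ ≤ s) (i : Fin ℓ) : shiftLeft 1 G i = carry g p i := by
  obtain ⟨i, hi⟩ := i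
  cases i with
  | zero => simp [shiftLeft, carry]
  | succ i => simp [shiftLeft, (h ⟨i, by omega⟩).1 (by simp; omega)]

/-- There is a carry into position `i` if the numbers formed by the lower bits add up to at least
`2 ^ i`. -/
theorem carry_bits (u v : Arith ℓ) {i : ℕ} (hi : i ≤ ℓ) :
    carry (bits u * bits v) (bits u + bits v) i =
      if 2 ^ i ≤ u.val % 2 ^ i + v.val % 2 ^ i then 1 else 0 := by
  induction i with
  | zero => simp [carry, Nat.mod_one]
  | succ i ih =>
    have hu := Nat.mod_lt u.val (Nat.two_pow_pos i)
    have hv := Nat.mod_lt v.val (Nat.two_pow_pos i)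
    rw [carry, dif_pos (by omega), ih (by omega)]
    simp only [Pi.add_apply, Pi.mul_apply, bits, Nat.mod_pow_succ]
    rw [pow_succ]
    rw [← ZMod.natCast_mod (u.val / 2 ^ i), ← ZMod.natCast_mod (v.val / 2 ^ i)]
    have h2 : (1 : ZMod 2) + 1 = 0 := by decide
    rcases Nat.mod_two_eq_zero_or_one (u.val / 2 ^ i) with ha | ha <;>
      rcases Nat.mod_two_eq_zero_or_one (v.val / 2 ^ i) with hb | hb <;>
      rw [ha, hb] <;> split_ifs <;> first | omega | simp [h2]

theorem bits_add (u v : Arith ℓ) (i : Fin ℓ) :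
    bits (u + v) i = bits u i + bits v i + carry (bits u * bits v) (bits u + bits v) i := by
  have hi := i.2
  rw [carry_bits u v hi.le]
  simp only [bits, ZMod.val_add]
  generalize u.val = a
  generalize v.val = b
  have hpow : 2 ^ ℓ = 2 ^ (i : ℕ) * 2 ^ (ℓ - i) := by rw [← pow_add]; congr 1; omega
  rw [hpow, Nat.mod_mul_right_div_self]
  -- Reduction modulo `2 ^ ℓ` does not affect the bits below `ℓ`.
  have hdvd : 2 ∣ 2 ^ (ℓ - (i : ℕ)) := dvd_pow_self 2 (by omega)
  rw [← ZMod.natCast_mod, Nat.mod_mod_of_dvd _ hdvd, ZMod.natCast_mod,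
    Nat.add_div (Nat.two_pow_pos _)]
  push_cast
  split_ifs <;> simp

end Carry

/-! ### Reasoning about straight-line code -/

section Code

variable {n k ℓ : ℕ} {α β : Type}

/-- Building a piece of code appends to the code that is already there. -/
def Extends (b : Build n k ℓ α) : Prop := ∀ code, code <+: (b code).2

@[simp]
theorem extends_pure (a : α) : Extends (pure a : Build n k ℓ α) := fun _ => List.prefix_rfl

@[simp]
theorem extends_emit (s : Step n k ℓ) : Extends (emit s) := fun _ => List.prefix_append _ _

@[simp]
theorem extends_bind {b : Build n k ℓ α} {f : α → Build n k ℓ β} (hb : Extends b)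
    (hf : ∀ a, Extends (f a)) : Extends (b >>= f) :=
  fun code => (hb code).trans (hf _ _)

@[simp]
theorem extends_map (f : α → β) {b : Build n k ℓ α} (hb : Extends b) : Extends (f <$> b) :=
  fun code => hb code

@[simp]
theorem extends_foldlM {f : β → α → Build n k ℓ β} (hf : ∀ b a, Extends (f b a)) (l : List α)
    (b : β) : Extends (l.foldlM f b) := by
  induction l generalizing b with
  | nil => exact extends_pure b
  | cons a l ih => exact extends_bind (hf b a) ih

@[simp]
theorem extends_mapM {f : α → Build n k ℓ β} (hf : ∀ a, Extends (f a)) (l : List α) :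
    Extends (l.mapM f) := by
  induction l with
  | nil => exact extends_pure []
  | cons a l ih => simp [List.mapM_cons, hf, ih]

@[simp]
theorem extends_carryLevel (gp : ℕ × ℕ) (d : ℕ) : Extends (carryLevel gp d : Build n k ℓ _) := by
  -- The premises of `extends_bind` nest as deeply as the code does.
  simp (maxDischargeDepth := 8) [carryLevel]

@[simp]
theorem extends_adder (a b : ℕ) : Extends (adder a b : Build n k ℓ _) := by
  simp (maxDischargeDepth := 8) [adder]

@[simp]
theorem extends_sumRound (l : List ℕ) : Extends (sumRound l : Build n k ℓ _) := by
  induction l using sumRound.induct with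
  | case1 a b l ih => simp [sumRound, ih]
  | case2 l h => rw [sumRound.eq_2 _ h]; simp

@[simp]
theorem extends_convertA2B (i : ℕ) : Extends (convertA2B i : Build n k ℓ _) := by
  simp (maxDischargeDepth := 8) [convertA2B]

@[simp]
theorem extends_convertB2A (i : ℕ) : Extends (convertB2A i : Build n k ℓ _) := by
  simp (maxDischargeDepth := 8) [convertB2A]

@[simp]
theorem extends_compile (env : List ℕ) (op : Op n k ℓ) : Extends (op.compile env) := by
  cases op <;> simp (maxDischargeDepth := 8) [Op.compile, comparator]

variable (x : Fin n → Fin k → Arith ℓ) (M : Fin n → Memory ℓ)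

/-- The memories `M` arise from an execution of `code`, as far as the values that they share are
concerned. Only steps that read earlier addresses count. -/
def Executes (code : List (Step n k ℓ)) : Prop :=
  ∀ t s, code[t]? = some s → (∀ i ∈ s.reads, i < t) → total M t = s.value x M

variable {x M}

theorem Executes.of_prefix {code code' : List (Step n k ℓ)} (h : Executes x M code')
    (hp : code <+: code') : Executes x M code := by
  intro t s hs
  obtain ⟨hlt, -⟩ := List.getElem?_eq_some_iff.1 hs
  exact h t s (by rw [← hs, List.prefix_iff_getElem?.1 hp t hlt, List.getElem?_eq_getElem hlt])

variable (x M)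

/-- The value `v` is shared at address `a`, which is below `N`. -/
def Holds (N a : ℕ) (v : Val ℓ) : Prop := a < N ∧ total M a = v

/-- If the code has length `N` before `b` is built and is executed, then `post` is true of the
result of `b` and of the length of the code after it. -/
def Ensures (N : ℕ) (b : Build n k ℓ α) (post : α → ℕ → Prop) : Prop :=
  ∀ code, code.length = N → Executes x M (b code).2 →
    N ≤ (b code).2.length ∧ post (b code).1 (b code).2.length

variable {x M} {N : ℕ}

theorem Holds.mono {N' a : ℕ} {v : Val ℓ} (h : Holds M N a v) (hN : N ≤ N') : Holds M N' a v :=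
  ⟨h.1.trans_le hN, h.2⟩

theorem Ensures.pure {a : α} {post : α → ℕ → Prop} (h : post a N) :
    Ensures x M N (Pure.pure a : Build n k ℓ α) post := by
  rintro code rfl -
  exact ⟨le_rfl, h⟩

/-- The rule of composition. That `f a` only appends is assumed separately, so that the facts about
`b` are available for the code built so far. -/
theorem Ensures.bind {b : Build n k ℓ α} {f : α → Build n k ℓ β} {mid : α → ℕ → Prop}
    {post : β → ℕ → Prop} (hb : Ensures x M N b mid) (hx : ∀ a, Extends (f a))
    (hf : ∀ a N', N ≤ N' → mid a N' → Ensures x M N' (f a) post) :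
    Ensures x M N (b >>= f) post := by
  intro code hN hM
  obtain ⟨h1, h2⟩ := hb code hN (hM.of_prefix (hx _ _))
  obtain ⟨h3, h4⟩ := hf _ _ h1 h2 _ rfl hM
  exact ⟨h1.trans h3, h4⟩

theorem Ensures.imp {b : Build n k ℓ α} {post post' : α → ℕ → Prop} (hb : Ensures x M N b post)
    (h : ∀ a N', N ≤ N' → post a N' → post' a N') : Ensures x M N b post' := by
  intro code hN hM
  obtain ⟨h1, h2⟩ := hb code hN hM
  exact ⟨h1, h _ _ h1 h2⟩

theorem ensures_emit {s : Step n k ℓ} {v : Val ℓ} (hs : ∀ i ∈ s.reads, i < N)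
    (hv : s.value x M = v) : Ensures x M N (emit s) (fun a N' => Holds M N' a v) := by
  rintro code rfl hM
  refine ⟨by simp [emit], by simp [emit], ?_⟩
  rw [← hv]
  exact hM _ s (by simp [emit]) hs

/-- The rule for loops over a list; the invariant refers to the elements treated so far. -/
theorem Ensures.foldlM {f : β → α → Build n k ℓ β} (inv : List α → β → ℕ → Prop) {l : List α}
    {b : β} (hb : inv [] b N) (hx : ∀ b a, Extends (f b a))
    (hf : ∀ done a rest b N', l = done ++ a :: rest → N ≤ N' → inv done b N' →
      Ensures x M N' (f b a) (inv (done ++ [a]))) :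
    Ensures x M N (l.foldlM f b) (inv l) := by
  suffices h : ∀ (rest done : List α) (b : β) (N' : ℕ), l = done ++ rest → N ≤ N' →
      inv done b N' → Ensures x M N' (rest.foldlM f b) (inv l) from h l [] b N rfl le_rfl hb
  intro rest
  induction rest with
  | nil =>
    intro done b N' hl _ h
    rw [List.append_nil] at hl
    exact Ensures.pure (hl ▸ h)
  | cons a rest ih =>
    intro done b N' hl hN h
    exact (hf done a rest b N' hl hN h).bind (fun _ => extends_foldlM hx _ _)
      fun b' N'' hN' h' => ih (done ++ [a]) b' N'' (by simpa using hl) (hN.trans hN') h'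

theorem Ensures.foldlM_range {f : β → ℕ → Build n k ℓ β} (inv : ℕ → β → ℕ → Prop) {m : ℕ}
    {b : β} (hb : inv 0 b N) (hx : ∀ b a, Extends (f b a))
    (hf : ∀ d b N', d < m → N ≤ N' → inv d b N' → Ensures x M N' (f b d) (inv (d + 1))) :
    Ensures x M N ((List.range m).foldlM f b) (inv m) := by
  have h := Ensures.foldlM (x := x) (M := M) (l := List.range m) (N := N) (f := f)
    (fun done => inv done.length) (b := b) (by simpa using hb) hx ?_
  · simpa using h
  · intro done a rest b N' hl hN h
    have hlen : m = done.length + (rest.length + 1) := by simpa using congrArg List.length hl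
    have ha : a = done.length := by
      have h1 := congrArg (fun l => l[done.length]?) hl
      simp [show done.length < m by omega] at h1
      exact h1.symm
    subst ha
    simpa using hf done.length b N' (by omega) hN h

theorem Ensures.mapM {f : α → Build n k ℓ β} {post : α → β → ℕ → Prop} {l : List α}
    (hmono : ∀ a b N N', N ≤ N' → post a b N → post a b N') (hx : ∀ a, Extends (f a))
    (hf : ∀ a N', N ≤ N' → Ensures x M N' (f a) (post a)) :
    Ensures x M N (l.mapM f) (fun r N' => List.Forall₂ (fun a b => post a b N') l r) := by
  induction l generalizing N with
  | nil => exact Ensures.pure .nil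
  | cons a l ih =>
    rw [List.mapM_cons]
    refine (hf a N le_rfl).bind (fun _ => extends_map _ (extends_mapM hx l)) fun b N1 hN1 hb => ?_
    refine (ih fun a N' hN' => hf a N' (hN1.trans hN')).bind (by simp) fun r N2 hN2 hr => ?_
    exact Ensures.pure (.cons (hmono _ _ _ _ hN2 hb) hr)

end Code

/-! ### Correctness of the compiled code -/

section Correctness

variable {n k ℓ : ℕ} {x : Fin n → Fin k → Arith ℓ} {M : Fin n → Memory ℓ} {N : ℕ}

theorem ensures_carryLevel {g p G Q : Word ℓ} {a b d : ℕ} (ha : Holds M N a { bin := G })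
    (hb : Holds M N b { bin := Q }) (h : IsLookahead g p (2 ^ d) G Q) :
    Ensures x M N (carryLevel (a, b) d) (fun r N' => ∃ G' Q', Holds M N' r.1 { bin := G' } ∧
      Holds M N' r.2 { bin := Q' } ∧ IsLookahead g p (2 ^ (d + 1)) G' Q') := by
  obtain ⟨ha, hG⟩ := ha
  obtain ⟨hb, hQ⟩ := hb
  unfold carryLevel
  refine (ensures_emit (v := { bin := shiftLeft (2 ^ d) G }) (by simpa [Step.reads])
    (by simp [Step.value, hG])).bind (by simp (maxDischargeDepth := 8)) fun a1 N1 h1 e1 => ?_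
  refine (ensures_emit (v := { bin := Q * shiftLeft (2 ^ d) G })
    (by simp [Step.reads, e1.1]; omega)
    (by simp [Step.value, hQ, e1.2])).bind (by simp (maxDischargeDepth := 8)) fun a2 N2 h2 e2 => ?_
  refine (ensures_emit (v := { bin := G + Q * shiftLeft (2 ^ d) G })
    (by simp [Step.reads, e2.1]; omega)
    (by simp [Step.value, hG, e2.2])).bind (by simp (maxDischargeDepth := 8)) fun a3 N3 h3 e3 => ?_
  refine (ensures_emit (v := { bin := shiftLeft (2 ^ d) Q }) (by simp [Step.reads]; omega)
    (by simp [Step.value, hQ])).bind (by simp (maxDischargeDepth := 8)) fun a4 N4 h4 e4 => ?_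
  refine (ensures_emit (v := { bin := Q * shiftLeft (2 ^ d) Q })
    (by simp [Step.reads, e4.1]; omega)
    (by simp [Step.value, hQ, e4.2])).bind (by simp) fun a5 N5 h5 e5 => ?_
  refine Ensures.pure ⟨_, _, e3.mono (by omega), e5, ?_⟩
  rw [pow_succ, mul_comm]
  exact h.double

theorem ensures_adder {u v : Arith ℓ} {a b : ℕ} (ha : Holds M N a { bin := bits u })
    (hb : Holds M N b { bin := bits v }) :
    Ensures x M N (adder a b) (fun r N' => Holds M N' r { bin := bits (u + v) }) := by
  obtain ⟨ha, hu⟩ := ha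
  obtain ⟨hb, hv⟩ := hb
  unfold adder
  refine (ensures_emit (v := { bin := bits u + bits v }) (by simp [Step.reads, ha, hb])
    (by simp [Step.value, hu, hv])).bind (by simp (maxDischargeDepth := 8)) fun p N1 h1 e1 => ?_
  refine (ensures_emit (v := { bin := bits u * bits v }) (by simp [Step.reads]; omega)
    (by simp [Step.value, hu, hv])).bind (by simp (maxDischargeDepth := 8)) fun g N2 h2 e2 => ?_
  refine (Ensures.foldlM_range (fun d r N' => ∃ G Q, Holds M N' r.1 { bin := G } ∧
    Holds M N' r.2 { bin := Q } ∧ IsLookahead (bits u * bits v) (bits u + bits v) (2 ^ d) G Q)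
    ⟨_, _, e2, e1.mono h2, isLookahead_one _ _⟩ (by simp) ?_).bind (by simp)
    fun gp N3 h3 ⟨G, Q, e3, _, hGQ⟩ => ?_
  · rintro d ⟨a, b⟩ N' - - ⟨G, Q, hG, hQ, h⟩
    exact ensures_carryLevel hG hQ h
  refine (ensures_emit (v := { bin := shiftLeft 1 G }) (by simpa [Step.reads] using e3.1)
    (by simp [Step.value, e3.2])).bind (by simp) fun c N4 h4 e4 => ?_
  have h5 := e1.1
  have h6 := e4.1
  refine ensures_emit (by simp [Step.reads]; omega) ?_
  simp only [Step.value, e1.2, e4.2, Val.mk.injEq, true_and]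
  ext i
  rw [bits_add, Pi.add_apply, Pi.add_apply, hGQ.shiftLeft_one (Nat.le_pow_clog one_lt_two ℓ)]

/-- The binary shared words at the addresses `l` are the bits of the numbers `us`. -/
def HoldBits (M : Fin n → Memory ℓ) (N : ℕ) (l : List ℕ) (us : List (Arith ℓ)) : Prop :=
  List.Forall₂ (fun a u => Holds M N a { bin := bits u }) l us

theorem HoldBits.mono {N' : ℕ} {l : List ℕ} {us : List (Arith ℓ)} (h : HoldBits M N l us)
    (hN : N ≤ N') : HoldBits M N' l us :=
  h.imp fun _ _ h => h.mono hN

theorem ensures_sumRound {l : List ℕ} {us : List (Arith ℓ)} (h : HoldBits M N l us) :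
    Ensures x M N (sumRound l) (fun r N' => ∃ us', HoldBits M N' r us' ∧ us'.sum = us.sum ∧
      r.length = (l.length + 1) / 2) := by
  induction l using sumRound.induct generalizing us N with
  | case1 a b l ih =>
    obtain _ | ⟨ha, h⟩ := h
    obtain _ | ⟨hb, h⟩ := h
    rw [sumRound]
    refine (ensures_adder ha hb).bind (by simp) fun s N1 h1 e1 => ?_
    refine (ih (HoldBits.mono h h1)).bind (by simp) fun r N2 h2 ⟨us', e2, hsum, hlen⟩ => ?_
    refine Ensures.pure ⟨_, .cons (e1.mono h2) e2, ?_, ?_⟩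
    · simp [hsum, add_assoc]
    · simp only [List.length_cons, hlen]
      omega
  | case2 l hl =>
    rw [sumRound.eq_2 _ hl]
    refine Ensures.pure ⟨us, h, rfl, ?_⟩
    match l, hl with
    | [], _ => rfl
    | [_], _ => simp
    | a :: b :: l, hl => exact (hl a b l rfl).elim

theorem ensures_convertA2B (hn : 0 < n) {a : ℕ} {v : Val ℓ} (ha : Holds M N a v) :
    Ensures x M N (convertA2B a) (fun r N' => Holds M N' r { bin := bits v.arith }) := by
  unfold convertA2B
  refine (Ensures.mapM
    (post := fun q r N' => Holds M N' r { bin := bits (M q a).arith })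
    (fun _ _ _ _ hN h => h.mono hN) (by simp) fun q N' hN' => ensures_emit
      (by simpa [Step.reads] using ha.1.trans_le hN') (by simp [Step.value])).bind
    (by simp (maxDischargeDepth := 8)) fun l N1 h1 e1 => ?_
  have hlen : l.length = n := by simpa using e1.length_eq.symm
  have e1' : HoldBits M N1 l ((List.finRange n).map fun q => (M q a).arith) := by
    unfold HoldBits
    rw [List.forall₂_map_right_iff]
    exact e1.flip
  have hsum : ((List.finRange n).map fun q => (M q a).arith).sum = v.arith := by
    rw [← ha.2, total, ← List.ofFn_eq_map, List.sum_ofFn]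
  -- Each round halves the number of words, rounding up, and preserves the sum of the numbers.
  refine (Ensures.foldlM_range (fun d l N' => ∃ us, HoldBits M N' l us ∧ us.sum = v.arith ∧
      0 < l.length ∧ l.length ≤ 2 ^ (Nat.clog 2 n - d))
    ⟨_, e1', hsum, hlen ▸ hn, by simpa [hlen] using Nat.le_pow_clog one_lt_two n⟩
    (by simp) ?_).bind (by simp) fun r N2 h2 ⟨us, e2, hus, hpos, hle⟩ => ?_
  · rintro d l N' hd - ⟨us, h, hus, hpos, hle⟩
    refine (ensures_sumRound h).imp fun r N'' _ ⟨us', h', hus', hr⟩ =>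
      ⟨us', h', hus'.trans hus, ?_, ?_⟩
    · omega
    · rw [show Nat.clog 2 n - d = (Nat.clog 2 n - (d + 1)) + 1 by omega, pow_succ] at hle
      omega
  · rw [Nat.sub_self, pow_zero] at hle
    refine Ensures.pure ?_
    match r, us, e2, hpos, hle with
    | [r], [u], .cons e _, _, _ =>
      rw [← hus]
      simpa using e

theorem ensures_convertB2A {a : ℕ} {v : Val ℓ} (ha : Holds M N a v) :
    Ensures x M N (convertB2A a) (fun r N' => Holds M N' r { arith := ofBits v.bin }) := by
  unfold convertB2A
  refine (ensures_emit (v := {}) (by simp [Step.reads]) rfl).bind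
    (by simp (maxDischargeDepth := 8)) fun z N1 h1 e1 => ?_
  refine (Ensures.foldlM_range (fun d r N' => Holds M N' r
    { arith := ∑ b ∈ Finset.range d, ((2 ^ b * (bitAt b v.bin).val : ℕ) : Arith ℓ) })
    (by simpa using e1) (by simp (maxDischargeDepth := 8)) ?_).imp fun r N' _ h => ?_
  · intro d acc N2 hd h2 e2
    refine (ensures_emit (v := { arith := ((bitAt d v.bin).val : ℕ) })
      (by simpa [Step.reads] using ha.1.trans_le (h1.trans h2)) (by simp [Step.value, ha.2])).bind
      (by simp) fun r N3 h3 e3 => ?_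
    refine (ensures_emit (v := { arith := ((2 ^ d * (bitAt d v.bin).val : ℕ) : Arith ℓ) })
      (by simpa [Step.reads] using e3.1) (by simp [Step.value, e3.2])).bind
      (by simp) fun r' N4 h4 e4 => ?_
    have h5 := e2.1
    refine ensures_emit (by simp [Step.reads, e4.1]; omega) ?_
    simp [Step.value, e2.2, e4.2, Finset.sum_range_succ]
  · rw [ofBits]
    convert h using 2
    rw [Finset.sum_range]
    exact Finset.sum_congr rfl fun i _ => by simp [bitAt]

/-- The sign bit of a ring element. -/
theorem sign_bit (z : Arith ℓ) :
    (((bitAt 0 (shiftRight (ℓ - 1) (bits z))).val : ℕ) : Arith ℓ) =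
      if signed z < 0 then 1 else 0 := by
  rcases Nat.eq_zero_or_pos ℓ with rfl | hℓ
  · exact Subsingleton.elim (α := ZMod 1) _ _
  have hz := ZMod.val_lt z
  have hpow : 2 ^ ℓ = 2 ^ (ℓ - 1) * 2 := by rw [← pow_succ]; congr 1; omega
  have hcast : ((2 ^ ℓ : ℕ) : ℤ) = 2 ^ ℓ := by push_cast; rfl
  simp only [bitAt, hℓ, dif_pos, shiftRight, zero_add, Nat.sub_lt hℓ one_pos, bits]
  by_cases h : 2 * z.val < 2 ^ ℓ
  · have h0 : z.val / 2 ^ (ℓ - 1) = 0 := Nat.div_eq_of_lt (by omega)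
    rw [h0, if_neg (by rw [signed, if_pos h]; omega)]
    simp
  · have h1 : z.val / 2 ^ (ℓ - 1) = 1 :=
      Nat.div_eq_of_lt_le (by omega) (by omega)
    rw [h1, if_pos (by rw [signed, if_neg h]; omega)]
    have hv : (1 : ZMod 2).val = 1 := rfl
    simp [hv]

theorem ensures_compile (hn : 0 < n) (op : Op n k ℓ) {env : List ℕ} {v : ℕ → Val ℓ}
    (h : ∀ r ∈ op.args, Holds M N (env.getD r.1 0) (v r.1)) :
    Ensures x M N (op.compile env) (fun a N' => Holds M N' a (op.eval x v)) := by
  cases op with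
  | a2b i => exact ensures_convertA2B hn (h _ (List.mem_singleton_self _))
  | b2a i => exact ensures_convertB2A (h _ (List.mem_singleton_self _))
  | ltz i =>
    unfold Op.compile comparator
    refine (ensures_convertA2B hn (h _ (List.mem_singleton_self _))).bind
      (by simp (maxDischargeDepth := 8)) fun w N1 h1 e1 => ?_
    refine (ensures_emit (v := { bin := shiftRight (ℓ - 1) (bits (v i).arith) })
      (by simpa [Step.reads] using e1.1) (by simp [Step.value, e1.2])).bind
      (by simp) fun s N2 h2 e2 => ?_
    exact ensures_emit (by simpa [Step.reads] using e2.1)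
      (by simp only [Step.value, e2.2, sign_bit, Op.eval])
  | _ =>
    simp only [Op.args, List.mem_cons, List.not_mem_nil, or_false, forall_eq_or_imp, forall_eq,
      Holds] at h
    exact ensures_emit (by simp [Step.reads]; try tauto) (by simp only [Step.value, Op.eval, h])

theorem Program.length_wires (x : Fin n → Fin k → Arith ℓ) (l : List (Op n k ℓ)) :
    (l.foldl (fun v op => v ++ [op.eval x fun i => v.getD i {}]) []).length = l.length := by
  induction l using List.reverseRecOn with
  | nil => rfl
  | append_singleton l op ih =>
    rw [List.foldl_append, List.foldl_cons, List.foldl_nil, List.length_append, ih]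
    simp

/-- The code of a well-formed program computes sharings of the values of its wires. -/
theorem Program.holds_addr {P : Program n k ℓ} (hP : P.WellFormed) (hn : 0 < n)
    (hM : Executes x M P.code) {i : ℕ} (hi : i < P.ops.length) :
    total M (P.addr i) = (P.wires x).getD i {} := by
  let W : List (Op n k ℓ) → List (Val ℓ) :=
    fun l => l.foldl (fun v op => v ++ [op.eval x fun i => v.getD i {}]) []
  have hW : ∀ l, (W l).length = l.length := Program.length_wires x
  have h := Ensures.foldlM (x := x) (M := M) (N := 0) (l := P.ops) (b := ([] : List ℕ))
    (f := fun env op => op.compile env >>= fun a => (Pure.pure (env ++ [a]) : Build n k ℓ _))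
    (fun done env N => env.length = done.length ∧
      ∀ i < done.length, Holds M N (env.getD i 0) ((W done).getD i {}))
    (by simp) (by simp) ?_
  · exact ((h [] rfl hM).2.2 i hi).2
  · rintro done op rest env N hops - ⟨hlen, henv⟩
    have hop : P.ops[done.length]? = some op := by rw [hops]; simp
    obtain ⟨hlt, hop⟩ := List.getElem?_eq_some_iff.1 hop
    have hargs : ∀ r ∈ op.args, r.1 < done.length := by
      rw [← hop]
      exact fun r hr => (hP.1 ⟨done.length, hlt⟩ r hr).1
    refine (ensures_compile hn op (v := fun i => (W done).getD i {})
      fun r hr => henv r.1 (hargs r hr)).bind (by simp) fun a N' hN' ha => Ensures.pure ?_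
    have hW' : W (done ++ [op]) = W done ++ [op.eval x fun i => (W done).getD i {}] := by
      simp only [W, List.foldl_append, List.foldl_cons, List.foldl_nil]
    refine ⟨by simp [hlen], fun i hi => ?_⟩
    rw [List.length_append, List.length_singleton, Nat.lt_succ_iff_lt_or_eq] at hi
    rw [hW']
    rcases hi with hi | rfl
    · rw [List.getD_append _ _ _ _ (by omega), List.getD_append _ _ _ _ (by rw [hW]; omega)]
      exact (henv i hi).mono hN'
    · rw [List.getD_append_right _ _ _ _ (by omega),
        List.getD_append_right _ _ _ _ (by rw [hW]), hW, hlen]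
      simpa using ha

/-- The output that the parties compute is the value of the functionality. -/
theorem Program.run_snd {P : Program n k ℓ} (hP : P.WellFormed) (hn : 0 < n)
    (C : Finset (Fin n)) (x : Fin n → Fin k → Arith ℓ) (m : Pair n → Tape P.code.length ℓ)
    (c : Fin P.code.length → Coins n ℓ) : (P.run C x m c).2 = P.eval x := by
  have hM : Executes x (memory P.code x m c P.code.length) P.code :=
    fun t s ht hs => total_memory P.code x m c hn ht hs
  have hlt : ∀ (i : ℕ) (κ : Kind), (P.ops[i]?).map Op.kind = some κ → i < P.ops.length := by
    intro i κ h
    by_contra hi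
    simp [List.getElem?_eq_none (not_lt.1 hi)] at h
  refine Prod.ext (funext fun o => ?_) (funext fun o => ?_)
  · have h := Program.holds_addr hP hn hM (hlt _ _ (hP.2.1 _ (List.get_mem P.outArith o)))
    simp only [Program.run, Program.eval, Prod.fst_sum, Finset.sum_apply, ← h, total]
  · have h := Program.holds_addr hP hn hM (hlt _ _ (hP.2.2 _ (List.get_mem P.outBin o)))
    simp only [Program.run, Program.eval, Prod.snd_sum, Finset.sum_apply, ← h, total]

end Correctness

/-! ### Twin executions -/

section Twin

variable {n k ℓ : ℕ}

theorem fst_zeroShare {R S : Type} [AddCommGroup R] [AddCommGroup S] (m : Pair n → R × S)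
    (p : Fin n) : (zeroShare m p).1 = zeroShare (fun e => (m e).1) p := by
  simp only [zeroShare, Prod.fst_sum]
  refine Finset.sum_congr rfl fun e _ => ?_
  split_ifs <;> rfl

theorem snd_zeroShare {R S : Type} [AddCommGroup R] [AddCommGroup S] (m : Pair n → R × S)
    (p : Fin n) : (zeroShare m p).2 = zeroShare (fun e => (m e).2) p := by
  simp only [zeroShare, Prod.snd_sum]
  refine Finset.sum_congr rfl fun e _ => ?_
  split_ifs <;> rfl

/-- The masks that transfer `d` from the zero-share of `p₀` to that of `q`. -/
def transfer {R : Type} [AddCommGroup R] (p₀ q : Fin n) (d : R) (e : Pair n) : R :=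
  if e.1 = (q, p₀) then d else if e.1 = (p₀, q) then -d else 0

theorem zeroShare_transfer {R : Type} [AddCommGroup R] {p₀ p : Fin n} (hp : p ≠ p₀) (q : Fin n)
    (d : R) : zeroShare (transfer p₀ q d) p = if p = q then d else 0 := by
  unfold zeroShare
  by_cases hpq : p = q
  · subst hpq
    rw [if_pos rfl]
    rcases lt_or_gt_of_ne hp with h | h
    · rw [Finset.sum_eq_single ⟨(p, p₀), h⟩]
      · simp [transfer]
      · rintro ⟨⟨a, b⟩, hab⟩ - hne
        have h1 : (a, b) ≠ (p, p₀) := fun h => hne (Subtype.ext h)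
        have h2 : (a, b) ≠ (p₀, p) := by
          rintro ⟨⟩
          exact absurd hab h.asymm
        simp [transfer, h1, h2]
      · simp
    · rw [Finset.sum_eq_single ⟨(p₀, p), h⟩]
      · simp [transfer, hp, hp.symm]
      · rintro ⟨⟨a, b⟩, hab⟩ - hne
        have h1 : (a, b) ≠ (p₀, p) := fun h => hne (Subtype.ext h)
        have h2 : (a, b) ≠ (p, p₀) := by
          rintro ⟨⟩
          exact absurd hab h.asymm
        simp [transfer, h1, h2]
      · simp
  · rw [if_neg hpq]
    refine Finset.sum_eq_zero ?_
    rintro ⟨⟨a, b⟩, hab⟩ -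
    simp only [transfer, Prod.mk.injEq]
    split_ifs <;> simp_all

/-- The coalition cannot notice a transfer that is needed for an honest party only: no mask that it
knows is changed. -/
theorem transfer_eq_zero {R : Type} [AddCommGroup R] {C : Finset (Fin n)} {p₀ q : Fin n}
    (hp₀ : p₀ ∉ C) {d : R} (hd : q ∈ C → d = 0) {e : Pair n} (he : e ∉ honestPairs C) :
    transfer p₀ q d e = 0 := by
  obtain ⟨⟨a, b⟩, hab⟩ := e
  have hq : ((a, b) = (q, p₀) ∨ (a, b) = (p₀, q)) → q ∈ C := by
    rintro (⟨⟨⟩⟩ | ⟨⟨⟩⟩) <;> simpa [honestPairs, hp₀] using he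
  unfold transfer
  split_ifs with h1 h2
  · exact hd (hq (.inl h1))
  · rw [hd (hq (.inr h2)), neg_zero]
  · rfl

theorem transfer_neg {R : Type} [AddCommGroup R] (p₀ q : Fin n) (d : R) :
    transfer p₀ q (-d) = -transfer p₀ q d := by
  funext e
  simp only [transfer, Pi.neg_apply]
  split_ifs <;> simp

/-- Adding `d` both to the shared value and to the coin of `p₀` changes the share of `p₀` only.
This is also true if `p₀` is the first party, whose coin is not used. -/
theorem dealShare_add_single {R : Type} [AddCommGroup R] (p₀ : Fin n) (s d : R) (z : Fin n → R)
    (p : Fin n) : dealShare (s + d) (z + Pi.single p₀ d) p =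
      dealShare s z p + if p = p₀ then d else 0 := by
  unfold dealShare
  by_cases h0 : (p : ℕ) = 0
  · simp only [h0, if_true, Pi.add_apply, Finset.sum_add_distrib]
    by_cases hp : p = p₀
    · subst hp
      have : ∑ q ∈ Finset.univ.erase p, (Pi.single p d : Fin n → R) q = 0 :=
        Finset.sum_eq_zero fun q hq => by rw [Pi.single_eq_of_ne (Finset.ne_of_mem_erase hq)]
      rw [this, if_pos rfl]
      abel
    · have : ∑ q ∈ Finset.univ.erase p, (Pi.single p₀ d : Fin n → R) q = d := by
        rw [Finset.sum_eq_single_of_mem p₀ (by simp [Ne.symm hp])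
          fun q _ hq => by rw [Pi.single_eq_of_ne hq], Pi.single_eq_same]
      rw [this, if_neg hp]
      abel
  · simp [h0, Pi.single_apply]

/-- The coins for the triple `(a + d, b + e, (a + d) * (b + e))` in place of `(a, b, a * b)`; only
the shares of `p₀` differ. -/
def shiftTriple {R : Type} [CommRing R] (p₀ : Fin n) (d e : R) (c : TripleCoins n R) :
    TripleCoins n R :=
  ((c.1.1 + d, c.1.2 + e), c.2.1 + Pi.single p₀ d, c.2.2.1 + Pi.single p₀ e,
    c.2.2.2 + Pi.single p₀ ((c.1.1 + d) * (c.1.2 + e) - c.1.1 * c.1.2))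

theorem dealTriple_shiftTriple {R : Type} [CommRing R] (p₀ : Fin n) (d e : R)
    (c : TripleCoins n R) (p : Fin n) : dealTriple (shiftTriple p₀ d e c) p =
      dealTriple c p +
        if p = p₀ then (d, e, (c.1.1 + d) * (c.1.2 + e) - c.1.1 * c.1.2) else 0 := by
  have h := dealShare_add_single p₀ (c.1.1 * c.1.2)
    ((c.1.1 + d) * (c.1.2 + e) - c.1.1 * c.1.2) c.2.2.2 p
  rw [add_sub_cancel] at h
  simp only [dealTriple, shiftTriple, dealShare_add_single, h]
  split_ifs <;> simp

theorem shiftTriple_neg {R : Type} [CommRing R] (p₀ : Fin n) (d e : R) (c : TripleCoins n R) :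
    shiftTriple p₀ (-d) (-e) (shiftTriple p₀ d e c) = c := by
  obtain ⟨⟨a, b⟩, za, zb, zab⟩ := c
  simp only [shiftTriple, add_assoc, ← Pi.single_add, add_neg_cancel,
    Pi.single_zero, add_zero, sub_add_sub_cancel, sub_self]

/-- The coins for the bit `r + d` in place of `r`; only the shares of `p₀` differ. -/
def shiftBit (p₀ : Fin n) (d : ZMod 2) (c : BitCoins n ℓ) : BitCoins n ℓ :=
  (c.1 + d,
    c.2.1 + Pi.single p₀ ((((c.1 + d).val : ℕ) : Arith ℓ) - ((c.1.val : ℕ) : Arith ℓ)),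
    c.2.2 + Pi.single p₀ d)

theorem dealBit_shiftBit (p₀ : Fin n) (d : ZMod 2) (c : BitCoins n ℓ) (p : Fin n) :
    dealBit (shiftBit p₀ d c) p = dealBit c p +
      if p = p₀ then ((((c.1 + d).val : ℕ) : Arith ℓ) - ((c.1.val : ℕ) : Arith ℓ), d) else 0 := by
  have h := dealShare_add_single p₀ ((c.1.val : ℕ) : Arith ℓ)
    ((((c.1 + d).val : ℕ) : Arith ℓ) - ((c.1.val : ℕ) : Arith ℓ)) c.2.1 p
  rw [add_sub_cancel] at h
  simp only [dealBit, shiftBit, dealShare_add_single, h]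
  split_ifs <;> simp

theorem shiftBit_neg (p₀ : Fin n) (d : ZMod 2) (c : BitCoins n ℓ) :
    shiftBit p₀ (-d) (shiftBit p₀ d c) = c := by
  obtain ⟨r, z, w⟩ := c
  simp only [shiftBit, add_assoc, ← Pi.single_add, add_neg_cancel,
    Pi.single_zero, add_zero, sub_add_sub_cancel, sub_self]

/-- The change of the masks for one step that hides a change of the inputs from `x` to `x'`: the
party `p₀` absorbs the change of the shares that other parties deal. -/
def maskShift (p₀ : Fin n) (x x' : Fin n → Fin k → Arith ℓ) :
    Step n k ℓ → Pair n → Arith ℓ × Word ℓ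
  | .shareArith q j => fun e => (transfer p₀ q (x q j - x' q j) e, 0)
  | .shareBin q j => fun e => (0, transfer p₀ q (bits (x q j) - bits (x' q j)) e)
  | _ => 0

/-- The change of the coins for one step that hides a change of the memory of `p₀` from `M`
to `M'`: the broadcast of `p₀` and the messages to the other parties stay the same. -/
def coinShift (p₀ : Fin n) (M M' : Memory ℓ) (c : Coins n ℓ) : Step n k ℓ → Coins n ℓ
  | .mul i j =>
    (shiftTriple p₀ ((M' i).arith - (M i).arith) ((M' j).arith - (M j).arith) c.1, c.2)
  | .and i j =>
    (c.1, shiftTriple p₀ ((M' i).bin - (M i).bin) ((M' j).bin - (M j).bin) c.2.1, c.2.2)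
  | .bit b i => (c.1, c.2.1, shiftBit p₀ (bitAt b (M i).bin - bitAt b (M' i).bin) c.2.2)
  | _ => c

theorem maskShift_swap (p₀ : Fin n) (x x' : Fin n → Fin k → Arith ℓ) (s : Step n k ℓ) :
    maskShift p₀ x' x s = -maskShift p₀ x x' s := by
  cases s with
  | shareArith q j =>
    funext e
    simp only [maskShift, Pi.neg_apply]
    rw [← neg_sub, transfer_neg]
    simp
  | shareBin q j =>
    funext e
    simp only [maskShift, Pi.neg_apply]
    rw [← neg_sub, transfer_neg]
    simp
  | _ => simp [maskShift]

theorem maskShift_eq_zero {C : Finset (Fin n)} {p₀ : Fin n} (hp₀ : p₀ ∉ C)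
    {x x' : Fin n → Fin k → Arith ℓ} (hx : ∀ p ∈ C, x p = x' p) (s : Step n k ℓ) {e : Pair n}
    (he : e ∉ honestPairs C) : maskShift p₀ x x' s e = 0 := by
  cases s with
  | shareArith q j =>
    simp only [maskShift]
    rw [transfer_eq_zero hp₀ (fun hq => by rw [hx q hq, sub_self]) he]
    rfl
  | shareBin q j =>
    simp only [maskShift]
    rw [transfer_eq_zero hp₀ (fun hq => by rw [hx q hq, sub_self]) he]
    rfl
  | _ => rfl

theorem coinShift_coinShift (p₀ : Fin n) (M M' : Memory ℓ) (c : Coins n ℓ) (s : Step n k ℓ) :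
    coinShift p₀ M' M (coinShift p₀ M M' c s) s = c := by
  cases s with
  | mul i j =>
    simp only [coinShift]
    rw [← neg_sub (M' i).arith, ← neg_sub (M' j).arith, shiftTriple_neg]
  | and i j =>
    simp only [coinShift]
    rw [← neg_sub (M' i).bin, ← neg_sub (M' j).bin, shiftTriple_neg]
  | bit b i =>
    simp only [coinShift]
    rw [← neg_sub (bitAt b (M i).bin), shiftBit_neg]
  | _ => rfl

theorem deal_coinShift {p₀ p : Fin n} (hp : p ≠ p₀) (M M' : Memory ℓ) (c : Coins n ℓ)
    (s : Step n k ℓ) : deal (coinShift p₀ M M' c s) p s = deal c p s := by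
  cases s <;> simp [deal, coinShift, dealTriple_shiftTriple, dealBit_shiftBit, hp]

/-- The broadcasts hide the memory of `p₀`: its change is absorbed by the coins. -/
theorem send_coinShift {p₀ : Fin n} {M M' : Fin n → Memory ℓ} (hM : ∀ p ≠ p₀, M p = M' p)
    (c : Coins n ℓ) (s : Step n k ℓ) (p : Fin n) :
    send (M' p) (deal (coinShift p₀ (M p₀) (M' p₀) c s) p s) s = send (M p) (deal c p s) s := by
  by_cases hp : p = p₀
  · subst hp
    cases s with
    | bit b i =>
      simp only [send, deal, coinShift, dealBit_shiftBit, if_true, Prod.snd_add]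
      congr 1
      ring
    | mul i j =>
      simp only [send, deal, coinShift, dealTriple_shiftTriple, if_true, Prod.fst_add,
        Prod.snd_add]
      congr 2 <;> ring
    | and i j =>
      simp only [send, deal, coinShift, dealTriple_shiftTriple, if_true, Prod.fst_add,
        Prod.snd_add]
      congr 2 <;> ring
    | _ => rfl
  · rw [deal_coinShift hp, hM p hp]

/-- The shares that the other parties compute do not depend on the inputs: the change is absorbed by
the masks that they have in common with `p₀`. -/
theorem receive_maskShift {p₀ p : Fin n} (hp : p ≠ p₀) (x x' : Fin n → Fin k → Arith ℓ)
    (m : Pair n → Arith ℓ × Word ℓ) (M : Memory ℓ) (d : Dealt ℓ) (msg : Fin n → Message ℓ)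
    (s : Step n k ℓ) :
    receive p (x' p) (zeroShare (m + maskShift p₀ x x' s) p) M d msg s =
      receive p (x p) (zeroShare m p) M d msg s := by
  rw [zeroShare_add]
  cases s with
  | shareArith q j =>
    simp only [receive, Prod.fst_add, maskShift, fst_zeroShare]
    rw [show (fun e => transfer p₀ q (x q j - x' q j) e) = transfer p₀ q (x q j - x' q j) from rfl,
      zeroShare_transfer hp]
    split_ifs with h
    · simp [h, add_assoc]
    · simp
  | shareBin q j =>
    simp only [receive, Prod.snd_add, maskShift, snd_zeroShare]
    rw [show (fun e => transfer p₀ q (bits (x q j) - bits (x' q j)) e) =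
      transfer p₀ q (bits (x q j) - bits (x' q j)) from rfl, zeroShare_transfer hp]
    split_ifs with h
    · simp [h, add_assoc]
    · simp
  | reshare q i => simp [receive, maskShift, zeroShare]
  | _ => rfl

theorem memory_congr (code : List (Step n k ℓ)) (x : Fin n → Fin k → Arith ℓ)
    {m m' : Pair n → Tape code.length ℓ} {c c' : Fin code.length → Coins n ℓ} {t : ℕ}
    (hm : ∀ i : Fin code.length, (i : ℕ) < t → ∀ e, m e i = m' e i)
    (hc : ∀ i : Fin code.length, (i : ℕ) < t → c i = c' i) :
    memory code x m c t = memory code x m' c' t := by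
  induction t with
  | zero => rfl
  | succ t ih =>
    have ih := ih (fun i hi => hm i (by omega)) (fun i hi => hc i (by omega))
    funext p
    by_cases ht : t < code.length
    · simp only [memory_succ _ _ _ _ ht, ih, hm ⟨t, ht⟩ (Nat.lt_succ_self t),
        hc ⟨t, ht⟩ (Nat.lt_succ_self t)]
    · simp [memory, ht, ih]

/-- A system of equations in which each component is determined by the components before it has
exactly one solution. -/
theorem existsUnique_of_causal {T : ℕ} {α : Type} [Nonempty α]
    (f : Fin T → (Fin T → α) → α) (hf : ∀ t r r', (∀ i < t, r i = r' i) → f t r = f t r') :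
    ∃! r : Fin T → α, ∀ t, r t = f t r := by
  classical
  let r : Fin T → α := wellFounded_lt.fix fun t ih =>
    f t fun i => if h : i < t then ih i h else Classical.arbitrary α
  have hr : ∀ t, r t = f t r := by
    intro t
    have h := wellFounded_lt.fix_eq (C := fun _ : Fin T => α)
      (fun t ih => f t fun i => if h : i < t then ih i h else Classical.arbitrary α) t
    refine h.trans (hf t _ _ fun i hi => ?_)
    simp only [hi, dif_pos]
    rfl
  refine ⟨r, hr, fun r' hr' => funext fun t => ?_⟩
  exact wellFounded_lt.induction (C := fun t => r' t = r t) t fun t ih => by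
    rw [hr' t, hr t, hf t _ _ ih]

/-- The randomness of one step: masks of all pairs, and the coins of the trusted third party. -/
abbrev StepRandom (n ℓ : ℕ) : Type := (Pair n → Arith ℓ × Word ℓ) × Coins n ℓ

/-- The memories before step `t` when the pairs in `H` take their masks from `r` and the other
pairs from `g`. -/
def memoryOf (code : List (Step n k ℓ)) (H : Finset (Pair n))
    (g : Pair n → Tape code.length ℓ) (x : Fin n → Fin k → Arith ℓ)
    (r : Fin code.length → StepRandom n ℓ) (t : ℕ) : Fin n → Memory ℓ :=
  memory code x (fun e => if e ∈ H then fun i => (r i).1 e else g e) (fun i => (r i).2) t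

/-- The randomness `r'` of an execution on inputs `x'` that looks the same to all parties but
`p₀` as the execution on inputs `x` with randomness `r`. -/
def IsTwin (code : List (Step n k ℓ)) (H : Finset (Pair n)) (g : Pair n → Tape code.length ℓ)
    (p₀ : Fin n) (x x' : Fin n → Fin k → Arith ℓ) (r r' : Fin code.length → StepRandom n ℓ) :
    Prop :=
  ∀ t, r' t = ((r t).1 + maskShift p₀ x x' code[t],
    coinShift p₀ (memoryOf code H g x r t p₀) (memoryOf code H g x' r' t p₀) (r t).2 code[t])

variable {code : List (Step n k ℓ)} {H : Finset (Pair n)} {g : Pair n → Tape code.length ℓ}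
  {p₀ : Fin n} {x x' : Fin n → Fin k → Arith ℓ} {r r' : Fin code.length → StepRandom n ℓ}

theorem IsTwin.symm (h : IsTwin code H g p₀ x x' r r') : IsTwin code H g p₀ x' x r' r := by
  intro t
  rw [h t, coinShift_coinShift, maskShift_swap]
  simp

theorem existsUnique_isTwin (code : List (Step n k ℓ)) (H : Finset (Pair n))
    (g : Pair n → Tape code.length ℓ) (p₀ : Fin n) (x x' : Fin n → Fin k → Arith ℓ)
    (r : Fin code.length → StepRandom n ℓ) : ∃! r', IsTwin code H g p₀ x x' r r' := by
  refine existsUnique_of_causal (fun t r' => ((r t).1 + maskShift p₀ x x' code[t],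
    coinShift p₀ (memoryOf code H g x r t p₀) (memoryOf code H g x' r' t p₀) (r t).2 code[t]))
    fun t r₁ r₂ h => ?_
  have hmem : memoryOf code H g x' r₁ t = memoryOf code H g x' r₂ t :=
    memory_congr code x' (fun i hi e => by
      split_ifs
      · exact congrArg (fun a => a.1 e) (h i hi)
      · rfl) (fun i hi => by rw [h i hi])
  simp only [hmem]

/-- Passing to the twin is a bijection of the randomness: its inverse is the same construction
with the two inputs exchanged. -/
theorem exists_equiv_isTwin (code : List (Step n k ℓ)) (H : Finset (Pair n))
    (g : Pair n → Tape code.length ℓ) (p₀ : Fin n) (x x' : Fin n → Fin k → Arith ℓ) :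
    ∃ φ : (Fin code.length → StepRandom n ℓ) ≃ (Fin code.length → StepRandom n ℓ),
      ∀ r, IsTwin code H g p₀ x x' r (φ r) := by
  choose φ hφ _ using existsUnique_isTwin code H g p₀ x x'
  choose ψ hψ _ using existsUnique_isTwin code H g p₀ x' x
  exact ⟨⟨φ, ψ, fun r => (existsUnique_isTwin code H g p₀ x' x (φ r)).unique (hψ _) (hφ r).symm,
    fun r => (existsUnique_isTwin code H g p₀ x x' (ψ r)).unique (hφ _) (hψ r).symm⟩, hφ⟩

/-- All parties but `p₀` hold the same shares in twin executions. -/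
theorem IsTwin.memoryOf_eq {C : Finset (Fin n)} (hp₀ : p₀ ∉ C) (hx : ∀ p ∈ C, x p = x' p)
    (h : IsTwin code (honestPairs C) g p₀ x x' r r') {t : ℕ} (ht : t ≤ code.length) :
    ∀ p ≠ p₀, memoryOf code (honestPairs C) g x r t p =
      memoryOf code (honestPairs C) g x' r' t p := by
  induction t with
  | zero => exact fun _ _ => rfl
  | succ t ih =>
    have ih := ih (by omega)
    intro p hp
    have hm : (fun e => (if e ∈ honestPairs C then fun i => (r' i).1 e else g e) ⟨t, ht⟩) =
        (fun e => (if e ∈ honestPairs C then fun i => (r i).1 e else g e) ⟨t, ht⟩) +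
          maskShift p₀ x x' code[t] := by
      funext e
      rw [Pi.add_apply]
      split_ifs with he
      · simp [h ⟨t, ht⟩]
      · rw [maskShift_eq_zero hp₀ hx _ he, add_zero]
    have hc : (r' ⟨t, ht⟩).2 = coinShift p₀ (memoryOf code (honestPairs C) g x r t p₀)
        (memoryOf code (honestPairs C) g x' r' t p₀) (r ⟨t, ht⟩).2 code[t] := by
      rw [h ⟨t, ht⟩]
      rfl
    have hs := send_coinShift ih (r ⟨t, ht⟩).2 code[t]
    unfold memoryOf at *
    rw [memory_succ _ _ _ _ ht, memory_succ _ _ _ _ ht, hm, hc, receive_maskShift hp,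
      deal_coinShift hp, ih p hp]
    simp only [hs]

/-- What the coalition received, if the final share of `p₀` in each output is set to the one that
makes the output equal to `y`. -/
def Received.forge {P : Program n k ℓ} {C : Finset (Fin n)} (p₀ : Fin n) (y : P.Output)
    (v : Received P C) : Received P C :=
  { v with opened := Function.update v.opened p₀ (y - ∑ p ∈ Finset.univ.erase p₀, v.opened p) }

/-- Twin executions give the same view once the opened share of `p₀` is corrected. -/
theorem IsTwin.run_eq {P : Program n k ℓ} (hP : P.WellFormed) {C : Finset (Fin n)}
    {g : Pair n → Tape P.code.length ℓ} {r r' : Fin P.code.length → StepRandom n ℓ}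
    (hp₀ : p₀ ∉ C) (hx : ∀ p ∈ C, x p = x' p)
    (h : IsTwin P.code (honestPairs C) g p₀ x x' r r') :
    P.run C x (fun e => if e ∈ honestPairs C then fun i => (r i).1 e else g e)
        (fun i => (r i).2) =
      ((P.run C x' (fun e => if e ∈ honestPairs C then fun i => (r' i).1 e else g e)
        (fun i => (r' i).2)).1.forge p₀ (P.eval x), P.eval x) := by
  have hout := Program.run_snd hP (Nat.zero_lt_of_lt p₀.2) C x
    (fun e => if e ∈ honestPairs C then fun i => (r i).1 e else g e) (fun i => (r i).2)
  have hmem := fun t ht => h.memoryOf_eq hp₀ hx (t := t) ht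
  refine Prod.ext ?_ hout
  -- The opened shares are the final ones, on which twins agree except for those of `p₀`.
  have hopen : ∀ p ≠ p₀,
      (P.run C x (fun e => if e ∈ honestPairs C then fun i => (r i).1 e else g e)
        (fun i => (r i).2)).1.opened p =
      (P.run C x' (fun e => if e ∈ honestPairs C then fun i => (r' i).1 e else g e)
        (fun i => (r' i).2)).1.opened p := by
    intro p hp
    have h1 := hmem _ le_rfl p hp
    simp only [memoryOf] at h1
    simp only [Program.run, h1]
  rw [show ∀ v w : Received P C, v = w ↔
    v.dealt = w.dealt ∧ v.broadcast = w.broadcast ∧ v.opened = w.opened by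
      rintro ⟨⟩ ⟨⟩; simp]
  refine ⟨?_, ?_, ?_⟩
  · funext t p
    have hp : (p : Fin n) ≠ p₀ := fun hp => hp₀ (hp ▸ p.2)
    simp only [Program.run, Received.forge]
    rw [h t, deal_coinShift hp]
  · funext t p
    have hs := send_coinShift (hmem t t.2.le) (r t).2 P.code[t] p
    have hc := congrArg Prod.snd (h t)
    simp only at hc
    rw [← hc] at hs
    exact hs.symm
  · funext p
    simp only [Received.forge]
    by_cases hp : p = p₀
    · subst hp
      rw [Function.update_self, ← hout,
        ← Finset.sum_congr rfl fun q hq => hopen q (Finset.ne_of_mem_erase hq)]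
      exact eq_sub_of_add_eq (Finset.add_sum_erase _ _ (Finset.mem_univ p))
    · rw [Function.update_of_ne hp, hopen p hp]

end Twin

/-! ### Uniform laws -/

section Uniform

variable {α β γ : Type} [Fintype α] [Nonempty α] [Fintype β] [Nonempty β]

theorem uniform_bind_equiv (φ : α ≃ β) (f : β → PMF γ) :
    (PMF.uniformOfFintype α).bind (fun a => f (φ a)) = (PMF.uniformOfFintype β).bind f := by
  have h : (PMF.uniformOfFintype α).map φ = PMF.uniformOfFintype β := by
    ext b
    rw [PMF.map_apply, tsum_eq_single (φ.symm b)]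
    · simp [Fintype.card_congr φ]
    · rintro a ha
      rw [if_neg]
      rintro rfl
      simp at ha
  rw [← h, PMF.bind_map]
  rfl

theorem uniform_bind_uniform (f : α → β → PMF γ) :
    (PMF.uniformOfFintype α).bind (fun a => (PMF.uniformOfFintype β).bind (f a)) =
      (PMF.uniformOfFintype (α × β)).bind fun p => f p.1 p.2 := by
  ext c
  simp only [PMF.bind_apply, tsum_fintype, PMF.uniformOfFintype_apply, Fintype.sum_prod_type,
    Fintype.card_prod, Finset.mul_sum]
  refine Finset.sum_congr rfl fun a _ => Finset.sum_congr rfl fun b _ => ?_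
  rw [← mul_assoc, Nat.cast_mul, ENNReal.mul_inv (by simp) (by simp)]

theorem uniform_bind_swap (φ : α × β ≃ α × β) (f : α → β → PMF γ) :
    (PMF.uniformOfFintype α).bind (fun a => (PMF.uniformOfFintype β).bind fun b =>
        f (φ (a, b)).1 (φ (a, b)).2) =
      (PMF.uniformOfFintype α).bind fun a => (PMF.uniformOfFintype β).bind (f a) := by
  rw [uniform_bind_uniform, uniform_bind_uniform]
  exact uniform_bind_equiv φ fun p => f p.1 p.2

variable {ι : Type} [Fintype ι] [DecidableEq ι]

/-- Drawing one coordinate of a uniform family anew does not change its law. -/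
theorem uniform_bind_update (i : ι) (f : (ι → α) → PMF γ) :
    (PMF.uniformOfFintype α).bind (fun a => (PMF.uniformOfFintype (ι → α)).bind fun s =>
        f (Function.update s i a)) = (PMF.uniformOfFintype (ι → α)).bind f := by
  -- The exchange of the new coordinate with the old one preserves the joint law.
  have hφ : Function.Involutive fun p : α × (ι → α) => (p.2 i, Function.update p.2 i p.1) := by
    rintro ⟨a, s⟩
    simp
  refine (uniform_bind_swap hφ.toPerm fun _ s => f s).trans ?_
  rw [PMF.bind_const]

/-- The coordinates of a uniform family in a subset form a uniform family. -/
theorem uniform_bind_restrict (p : ι → Prop) [DecidablePred p]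
    (f : ({i // p i} → α) → PMF γ) :
    (PMF.uniformOfFintype (ι → α)).bind (fun s => f fun i => s i) =
      (PMF.uniformOfFintype ({i // p i} → α)).bind f := by
  refine (uniform_bind_equiv (Equiv.piEquivPiSubtypeProd p fun _ => α) fun q => f q.1).trans ?_
  rw [← uniform_bind_uniform fun s (_ : {i // ¬p i} → α) => f s]
  simp only [PMF.bind_const]

end Uniform

/-! ### Simulation -/

section Simulation

variable {n k ℓ : ℕ}

/-- The simulator executes the protocol with zeros in place of the inputs of the honest parties,
uniform masks for the honest pairs and fresh coins of the trusted third party, and corrects the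
opened shares of the honest party `p₀`. -/
noncomputable def simulator (P : Program n k ℓ) (C : Finset (Fin n)) (p₀ : Fin n) :
    Simulator P C := fun xC y g =>
  (PMF.uniformOfFintype (Pair n → Tape P.code.length ℓ)).bind fun u =>
    (PMF.uniformOfFintype (Fin P.code.length → Coins n ℓ)).map fun c =>
      (P.run C (fun p => if h : p ∈ C then xC ⟨p, h⟩ else 0)
        (fun e => if h : e ∈ honestPairs C then u e else g ⟨e, h⟩) c).1.forge p₀ y

/-- The experiment between the real and the ideal one in which the pairs in `S` use uniform masks,
and the other pairs use masks generated from their seeds. -/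
noncomputable def hybrid (P : Program n k ℓ) (C : Finset (Fin n)) {Seed : Type} [Fintype Seed]
    [Nonempty Seed] (G : Seed → Tape P.code.length ℓ) (x : Fin n → Fin k → Arith ℓ)
    (S : Finset (Pair n)) : PMF (View P C Seed × P.Output) :=
  (PMF.uniformOfFintype (Pair n → Seed)).bind fun s =>
    (PMF.uniformOfFintype (Pair n → Tape P.code.length ℓ)).bind fun u =>
      (PMF.uniformOfFintype (Fin P.code.length → Coins n ℓ)).map fun c =>
        let r := P.run C x (fun e => if e ∈ S then u e else G (s e)) c
        (⟨fun p => x p, fun e => s e, r.1⟩, r.2)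

variable {P : Program n k ℓ} {C : Finset (Fin n)} {Seed : Type} [Fintype Seed] [Nonempty Seed]

theorem real_eq_hybrid (G : Seed → Tape P.code.length ℓ) (x : Fin n → Fin k → Arith ℓ) :
    P.real C G x = hybrid P C G x ∅ := by
  simp [Program.real, hybrid]

/-- Passing to twins with vanishing honest inputs turns an execution with uniform masks of the
honest pairs into a simulated one. -/
theorem uniform_run_eq {γ : Type} (hP : P.WellFormed) {p₀ : Fin n} (hp₀ : p₀ ∉ C)
    (g : Pair n → Tape P.code.length ℓ) {x x' : Fin n → Fin k → Arith ℓ}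
    (hx : ∀ p ∈ C, x p = x' p) (f : Received P C × P.Output → PMF γ) :
    ((PMF.uniformOfFintype (Pair n → Tape P.code.length ℓ)).bind fun u =>
      (PMF.uniformOfFintype (Fin P.code.length → Coins n ℓ)).bind fun c =>
        f (P.run C x (fun e => if e ∈ honestPairs C then u e else g e) c)) =
    (PMF.uniformOfFintype (Pair n → Tape P.code.length ℓ)).bind fun u =>
      (PMF.uniformOfFintype (Fin P.code.length → Coins n ℓ)).bind fun c =>
        f ((P.run C x' (fun e => if e ∈ honestPairs C then u e else g e) c).1.forge p₀ (P.eval x),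
          P.eval x) := by
  -- Both executions are written in terms of the randomness of the steps, where twins live.
  let ψ : (Fin P.code.length → StepRandom n ℓ) ≃
      (Pair n → Tape P.code.length ℓ) × (Fin P.code.length → Coins n ℓ) :=
    { toFun := fun r => (fun e i => (r i).1 e, fun i => (r i).2)
      invFun := fun q i => (fun e => q.1 e i, q.2 i)
      left_inv := fun _ => rfl
      right_inv := fun _ => rfl }
  obtain ⟨φ, hφ⟩ := exists_equiv_isTwin P.code (honestPairs C) g p₀ x x'
  rw [uniform_bind_uniform, uniform_bind_uniform, ← uniform_bind_equiv ψ, ← uniform_bind_equiv ψ]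
  refine Eq.trans ?_ (uniform_bind_equiv φ _)
  congr 1
  funext r
  exact congrArg f ((hφ r).run_eq hP hp₀ hx)

/-- With uniform masks for all honest pairs, the seeds of these pairs play no role, and the execution
is the simulated one. -/
theorem hybrid_honestPairs (hP : P.WellFormed) {p₀ : Fin n} (hp₀ : p₀ ∉ C)
    (G : Seed → Tape P.code.length ℓ) (x : Fin n → Fin k → Arith ℓ) :
    hybrid P C G x (honestPairs C) = P.ideal C (simulator P C p₀) G x := by
  unfold hybrid Program.ideal
  rw [← uniform_bind_restrict fun e => e ∉ honestPairs C]
  congr 1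
  funext s
  have h := uniform_run_eq hP hp₀ (fun e => G (s e)) (x := x)
    (x' := fun p => if p ∈ C then x p else 0) (fun p hp => by simp [hp])
    (fun r => PMF.pure ((⟨fun p => x p, fun e => s e, r.1⟩, r.2) : View P C Seed × P.Output))
  simp only [simulator, PMF.map_bind, PMF.map_comp]
  exact h

/-- With truly random masks, the masks that the honest pairs use are independent of the seeds that
the coalition sees. -/
theorem hybrid_id (S : Finset (Pair n)) (hS : S ⊆ honestPairs C) (x : Fin n → Fin k → Arith ℓ) :
    hybrid P C (id : Tape P.code.length ℓ → Tape P.code.length ℓ) x S = hybrid P C id x ∅ := by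
  -- Exchanging seeds and uniform masks of the pairs in `S` preserves the joint law.
  have hφ : Function.Involutive
      fun q : (Pair n → Tape P.code.length ℓ) × (Pair n → Tape P.code.length ℓ) =>
        ((fun e => if e ∈ S then q.2 e else q.1 e, fun e => if e ∈ S then q.1 e else q.2 e) :
          (Pair n → Tape P.code.length ℓ) × (Pair n → Tape P.code.length ℓ)) := by
    rintro ⟨s, u⟩
    refine Prod.ext (funext fun e => ?_) (funext fun e => ?_) <;> by_cases he : e ∈ S <;> simp [he]
  unfold hybrid
  rw [← uniform_bind_swap hφ.toPerm]
  simp only [Function.Involutive.coe_toPerm, Finset.notMem_empty, if_false, id]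
  have hk : ∀ (e : {e : Pair n // e ∉ honestPairs C}), (e : Pair n) ∉ S := fun e he => e.2 (hS he)
  have hm : ∀ s u : Pair n → Tape P.code.length ℓ,
      (fun e => if e ∈ S then if e ∈ S then s e else u e else if e ∈ S then u e else s e) = s := by
    intro s u
    funext e
    split_ifs <;> rfl
  simp only [hk, if_false, hm]

/-- The seed of an honest pair is not part of the view, so it may be drawn outside of the execution,
as the argument of the test. -/
theorem hybrid_bind (G : Seed → Tape P.code.length ℓ) (x : Fin n → Fin k → Arith ℓ)
    (D : View P C Seed × P.Output → PMF Bool) {e : Pair n} (he : e ∈ honestPairs C)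
    {S : Finset (Pair n)} (heS : e ∉ S) : (hybrid P C G x S).bind D =
      ((PMF.uniformOfFintype Seed).map G).bind (P.tapeTest C G x D e S) := by
  unfold hybrid Program.tapeTest
  simp only [PMF.bind_bind, PMF.bind_map, Function.comp_def]
  rw [← uniform_bind_update e]
  have hk : ∀ (e' : {e' : Pair n // e' ∉ honestPairs C}), (e' : Pair n) ≠ e :=
    fun e' h => e'.2 (h ▸ he)
  have hm : ∀ (a : Seed) (s : Pair n → Seed) (u : Pair n → Tape P.code.length ℓ),
      (fun e' => if e' ∈ S then u e' else G (if e' = e then a else s e')) =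
        fun e' => if e' = e then G a else if e' ∈ S then u e' else G (s e') := by
    intro a s u
    funext e'
    by_cases h : e' = e
    · subst h
      simp [heS]
    · simp [h]
  simp only [Function.update_apply, hk, if_false, hm]

theorem hybrid_insert_bind (G : Seed → Tape P.code.length ℓ) (x : Fin n → Fin k → Arith ℓ)
    (D : View P C Seed × P.Output → PMF Bool) (e : Pair n) (S : Finset (Pair n)) :
    (hybrid P C G x (insert e S)).bind D =
      (PMF.uniformOfFintype (Tape P.code.length ℓ)).bind (P.tapeTest C G x D e S) := by
  unfold hybrid Program.tapeTest
  simp only [PMF.bind_bind, PMF.bind_map, Function.comp_def]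
  rw [PMF.bind_comm (PMF.uniformOfFintype (Tape P.code.length ℓ))]
  congr 1
  funext s
  rw [← uniform_bind_update e]
  have hm : ∀ (a : Tape P.code.length ℓ) (u : Pair n → Tape P.code.length ℓ),
      (fun e' => if e' ∈ insert e S then Function.update u e a e' else G (s e')) =
        fun e' => if e' = e then a else if e' ∈ S then u e' else G (s e') := by
    intro a u
    funext e'
    by_cases h : e' = e
    · subst h
      simp
    · simp [h]
  simp only [hm]

/-- The hybrid argument: replacing the generated masks of the pairs in `S` by uniform ones, one
pair at a time, costs at most `η` for each pair. -/
theorem advantage_hybrid_le (G : Seed → Tape P.code.length ℓ) (x : Fin n → Fin k → Arith ℓ)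
    (D : View P C Seed × P.Output → PMF Bool) {η : ℝ}
    (hη : ∀ e₀ ∈ honestPairs C, ∀ S ⊆ honestPairs C,
      generatorAdvantage G (P.tapeTest C G x D e₀ S) ≤ η)
    {S : Finset (Pair n)} (hS : S ⊆ honestPairs C) :
    advantage D (hybrid P C G x ∅) (hybrid P C G x S) ≤ S.card * η := by
  induction S using Finset.induction_on with
  | empty => simp [advantage]
  | insert e S heS ih =>
    rw [Finset.insert_subset_iff] at hS
    have h := hη e hS.1 S hS.2
    rw [generatorAdvantage, advantage, ← hybrid_bind G x D hS.1 heS,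
      ← hybrid_insert_bind G x D e S] at h
    have ih := ih hS.2
    rw [advantage] at ih ⊢
    rw [Finset.card_insert_of_notMem heS]
    refine (abs_sub_le _ (((hybrid P C G x S).bind D) true).toReal _).trans ?_
    push_cast
    linarith

end Simulation

end CrypTen

theorem mainTheorem1 (n k ℓ : ℕ) (P : CrypTen.Program n k ℓ) (hP : P.WellFormed)
    (C : Finset (Fin n)) (hC : C.card < n) :
    ∃ Sim : CrypTen.Simulator P C,
      (∀ x : Fin n → Fin k → CrypTen.Arith ℓ,
        P.real C (id : CrypTen.Tape P.code.length ℓ → CrypTen.Tape P.code.length ℓ) x =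
          P.ideal C Sim id x) ∧
      ∀ (Seed : Type) [Fintype Seed] [Nonempty Seed]
        (G : Seed → CrypTen.Tape P.code.length ℓ)
        (x : Fin n → Fin k → CrypTen.Arith ℓ)
        (D : CrypTen.View P C Seed × P.Output → PMF Bool) (η : ℝ),
        (∀ e₀ ∈ CrypTen.honestPairs C, ∀ S ⊆ CrypTen.honestPairs C,
          CrypTen.generatorAdvantage G (P.tapeTest C G x D e₀ S) ≤ η) →
        CrypTen.advantage D (P.real C G x) (P.ideal C Sim G x) ≤
          (CrypTen.honestPairs C).card * η := by
  obtain ⟨p₀, hp₀⟩ : ∃ p₀, p₀ ∉ C := by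
    by_contra! h
    simp [Finset.eq_univ_iff_forall.2 h] at hC
  refine ⟨CrypTen.simulator P C p₀, fun x => ?_, fun Seed _ _ G x D η hη => ?_⟩
  · rw [CrypTen.real_eq_hybrid, ← CrypTen.hybrid_id (CrypTen.honestPairs C) subset_rfl,
      CrypTen.hybrid_honestPairs hP hp₀]
  · rw [CrypTen.real_eq_hybrid, ← CrypTen.hybrid_honestPairs hP hp₀]
    exact CrypTen.advantage_hybrid_le G x D hη subset_rfl
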